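/- Let $n\ge 2$ and consider an $n\times n$ input-queued switch in discrete time. If $q_{ij}(t)\in\mathbb Z_{\ge0}$ is the number of packets waiting at input $i$ for output $j$, then $q_{ij}(t+1)=\max\{q_{ij}(t)+a_{ij}(t)-s_{ij}(t),0\}$. Here $s(t)\in\{0,1\}^{n\times n}$ is the schedule, a matrix with all row and column sums at most $1$, chosen (possibly at random) by a scheduling policy on the basis of the history up to time $t$ including $q(t)$; the arrivals $a(t)\in\mathbb Z_{\ge0}^{n\times n}$ are i.i.d. in $t$, independent of the past and of $s(t)$, with independent entries. Under the MaxWeight policy $s(t)$ is a permutation matrix that maximizes $\sum_{ij}q_{ij}(t)s_{ij}$ over all schedules; ties are broken by any (possibly randomized) rule that depends on $q(t)$ only. Let $\mathcal C=\{x\in\mathbb R_{\ge0}^{n\times n}:\sum_j x_{ij}\le1\ \forall i,\ \sum_i x_{ij}\le1\ \forall j\}$ and $\mathcal F_{10}=\{x\in\mathcal C:\sum_j x_{1j}=1\}$. Let $\nu$ be in the relative interior of $\mathcal F_{10}$ with $\min_{ij}\nu_{ij}>0$. Consider a family of such switches indexed by $0<\epsilon<1$ in which $a^{(\epsilon)}_{ij}(t)\le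 a_{\max}$ for a constant $a_{\max}$ independent of $\epsilon$, $E[a^{(\epsilon)}(t)]=(1-\epsilon)\nu$, and $\mathrm{Var}[a^{(\epsilon)}_{ij}(t)]\to\sigma_{ij}^2$ as $\epsilon\downarrow0$ for all $i,j$. Then, under MaxWeight, for each $\epsilon\in(0,1)$ the queue lengths $q^{(\epsilon)}(t)$ converge in distribution as $t\to\infty$, for every initial law, to a steady-state random matrix $\bar q^{(\epsilon)}$ whose law does not depend on the initial law, and $$\lim_{\epsilon\downarrow0}\epsilon\,E\Big[\sum_j\bar q^{(\epsilon)}_{1j}\Big]=\frac12\sum_j\sigma_{1j}^2,\qquad \lim_{\epsilon\downarrow0}\epsilon\,E\big[\bar q^{(\epsilon)}_{ij}\big]=0\quad\text{for all } i>1 \text{ and all } j.$$ Moreover, MaxWeight is heavy-traffic optimal: for any scheduling policies (which may depend on $\epsilon$) and initial laws for which, for each $\epsilon\in(0,1)$, the queue lengths of the $\epsilon$-th system converge in distribution to a random matrix $\bar r^{(\epsilon)}$ with finite entries, $$\liminf_{\epsilon\downarrow0}\epsilon\,E\Big[\sum_j\bar r^{(\epsilon)}_{1j}\Big]\ \ge\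 \frac12\sum_j\sigma_{1j}^2,$$ the value attained by MaxWeight (expectations are in $[0,\infty]$). -/

import Mathlib

open Filter Topology MeasureTheory ProbabilityTheory
open scoped ENNReal

/-- The capacity region of the `n × n` switch: nonnegative rate matrices all of whose row sums
and column sums are at most `1`. -/
def capacityRegion (n : ℕ) : Set (Fin n → Fin n → ℝ) :=
  {x | (∀ i j, 0 ≤ x i j) ∧ (∀ i, ∑ j, x i j ≤ 1) ∧ (∀ j, ∑ i, x i j ≤ 1)}

/-- The face of the capacity region on which the first `n₁` input ports (rows) and the first
`n₂` output ports (columns) are saturated. -/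
def saturatedFace (n n₁ n₂ : ℕ) : Set (Fin n → Fin n → ℝ) :=
  {x | x ∈ capacityRegion n ∧ (∀ i : Fin n, i.val < n₁ → ∑ j, x i j = 1) ∧
    (∀ j : Fin n, j.val < n₂ → ∑ i, x i j = 1)}

/-- `n × n` matrices of natural numbers: queue lengths, numbers of arrivals, schedules. -/
abbrev SwitchMat (n : ℕ) : Type := Fin n → Fin n → ℕ

/-- Feasible schedules: in every slot each input port is connected to at most one output port
and conversely (so that the entries are `0` or `1`). -/
def IsSchedule {n : ℕ} (s : SwitchMat n) : Prop :=
  (∀ i, ∑ j, s i j ≤ 1) ∧ (∀ j, ∑ i, s i j ≤ 1)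

/-- Maximal schedules, i.e. permutation matrices. -/
def IsMaximalSchedule {n : ℕ} (s : SwitchMat n) : Prop :=
  (∀ i, ∑ j, s i j = 1) ∧ (∀ j, ∑ i, s i j = 1)

/-- The weight of a schedule for given queue lengths. -/
def scheduleWeight {n : ℕ} (q s : SwitchMat n) : ℕ := ∑ i, ∑ j, q i j * s i j

/-- Everything a scheduler may have seen before it chooses a schedule: the current queue lengths,
and the list of the (queue lengths, schedule, arrivals) of all the previous slots, the most recent
slot first. -/
abbrev SwitchHistory (n : ℕ) : Type :=
  SwitchMat n × List (SwitchMat n × SwitchMat n × SwitchMat n)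

/-- A scheduling policy: a random feasible schedule, chosen on the basis of the history. -/
structure SchedulingPolicy (n : ℕ) where
  choose : SwitchHistory n → PMF (SwitchMat n)
  feasible : ∀ h, ∀ s ∈ (choose h).support, IsSchedule s

/-- MaxWeight: the choice depends on the current queue lengths only, and is always a maximal
schedule of the largest weight; ties are broken by an arbitrary, possibly randomized, rule
(for example uniformly at random). -/
def SchedulingPolicy.IsMaxWeight {n : ℕ} (p : SchedulingPolicy n) : Prop :=
  ∃ r : SwitchMat n → PMF (SwitchMat n), (∀ h, p.choose h = r h.1) ∧
    ∀ q, ∀ s ∈ (r q).support, IsMaximalSchedule s ∧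
      ∀ s', IsSchedule s' → scheduleWeight q s' ≤ scheduleWeight q s

/-- One time slot of the switch: a schedule `s` is chosen, then arrivals `a` occur, which are
independent of the past and of `s` and have law `A`, and then queue `(i, j)` becomes
`max (q i j + a i j - s i j) 0` (the subtraction is that of natural numbers). -/
noncomputable def switchStep {n : ℕ} (A : PMF (SwitchMat n)) (p : SchedulingPolicy n)
    (h : SwitchHistory n) : PMF (SwitchHistory n) :=
  (p.choose h).bind fun s => A.map fun a =>
    ((fun i j => h.1 i j + a i j - s i j), (h.1, s, a) :: h.2)

/-- The law of the history at time `t`, with i.i.d. arrivals of law `A` and queue lengths of law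
`init` at time `0`. -/
noncomputable def historyLaw {n : ℕ} (A : PMF (SwitchMat n)) (p : SchedulingPolicy n)
    (init : PMF (SwitchMat n)) : ℕ → PMF (SwitchHistory n)
  | 0 => init.map fun q => (q, [])
  | t + 1 => (historyLaw A p init t).bind (switchStep A p)

/-- The law of the queue lengths at time `t`. -/
noncomputable def queueLaw {n : ℕ} (A : PMF (SwitchMat n)) (p : SchedulingPolicy n)
    (init : PMF (SwitchMat n)) (t : ℕ) : PMF (SwitchMat n) :=
  (historyLaw A p init t).map Prod.fst

/-- The queue lengths converge in distribution to the law `π` (on a countable discrete space this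
is the convergence of the probabilities of all points to those of a probability law). -/
def QueueConvergesTo {n : ℕ} (A : PMF (SwitchMat n)) (p : SchedulingPolicy n)
    (init π : PMF (SwitchMat n)) : Prop :=
  ∀ q, Tendsto (fun t => queueLaw A p init t q) atTop (𝓝 (π q))

/-- `A` is the law of the arrivals in one slot: independent in different queues, at most `amax`
in each of them, and with mean rates `lam`. -/
structure IsArrivalLaw {n : ℕ} (A : PMF (SwitchMat n)) (amax : ℕ)
    (lam : Fin n → Fin n → ℝ) : Prop where
  indep : iIndepFun (fun (ij : Fin n × Fin n) (a : SwitchMat n) => a ij.1 ij.2) A.toMeasure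
  bounded : ∀ a ∈ A.support, ∀ i j, a i j ≤ amax
  mean : ∀ i j, ∫ a, (a i j : ℝ) ∂A.toMeasure = lam i j

/-- The variance of the arrivals to queue `(i, j)` in one slot. -/
noncomputable def arrivalVar {n : ℕ} (A : PMF (SwitchMat n)) (i j : Fin n) : ℝ :=
  variance (fun a : SwitchMat n => (a i j : ℝ)) A.toMeasure

/-- The mean length of queue `(i, j)` under the law `π`, a number in `[0, ∞]`. -/
noncomputable def meanQueue {n : ℕ} (π : PMF (SwitchMat n)) (i j : Fin n) : ℝ≥0∞ :=
  ∫⁻ q, (q i j : ℝ≥0∞) ∂π.toMeasure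

/-- The mean total queue length at input port `i` under the law `π`, a number in `[0, ∞]`. -/
noncomputable def meanRowQueue {n : ℕ} (π : PMF (SwitchMat n)) (i : Fin n) : ℝ≥0∞ :=
  ∫⁻ q, ∑ j, (q i j : ℝ≥0∞) ∂π.toMeasure

/-!
Whatever the policy, the content of the saturated row dominates a single-server queue
`k' = max (k + a - 1) 0` with the same arrivals. The test function `k * (k + 1)` vanishes both at
`-1` and at `0`, so its drift does not see the idle slots; this gives the universal lower bound.

Under MaxWeight the queue lengths drift towards the line on which the saturated row is constant and
all the other rows vanish, at a rate that does not depend on the load `1 - ε`, so that the moments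
of the distance to this line stay bounded. Adding a small multiple of the fourth power of that
distance to the squared content of the saturated row, shifted by `n * L`, controls the unused
service, and `L = 1 / √ε` gives a matching upper bound.

Convergence to the steady state needs no coupling: Foster's drift condition provides invariant laws,
and on their supports the bounded subharmonic functions of the chain are constant. This is applied
to two independent copies of the chain and to the asymptotic difference of their laws.
-/

/-- The expectation of a `[0, ∞]`-valued function under a probability mass function. It is defined
as a series, so that no measurable structure is needed. -/
noncomputable def pmfExp {α : Type*} (p : PMF α) (F : α → ℝ≥0∞) : ℝ≥0∞ := ∑' x, p x * F x

section PmfExp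

variable {α β : Type*}

lemma pmfExp_mono {p : PMF α} {F G : α → ℝ≥0∞} (h : ∀ x ∈ p.support, F x ≤ G x) :
    pmfExp p F ≤ pmfExp p G := by
  refine ENNReal.tsum_le_tsum fun x => ?_
  by_cases hx : x ∈ p.support
  · exact mul_le_mul_right (h x hx) _
  · simp [(PMF.apply_eq_zero_iff p x).2 hx]

lemma pmfExp_congr {p : PMF α} {F G : α → ℝ≥0∞} (h : ∀ x ∈ p.support, F x = G x) :
    pmfExp p F = pmfExp p G :=
  (pmfExp_mono fun x hx => (h x hx).le).antisymm (pmfExp_mono fun x hx => (h x hx).ge)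

lemma pmfExp_const (p : PMF α) (c : ℝ≥0∞) : pmfExp p (fun _ => c) = c := by
  simp [pmfExp, ENNReal.tsum_mul_right, p.tsum_coe]

lemma pmfExp_add (p : PMF α) (F G : α → ℝ≥0∞) :
    pmfExp p (fun x => F x + G x) = pmfExp p F + pmfExp p G := by
  simp [pmfExp, mul_add, ENNReal.tsum_add]

lemma pmfExp_const_mul (p : PMF α) (c : ℝ≥0∞) (F : α → ℝ≥0∞) :
    pmfExp p (fun x => c * F x) = c * pmfExp p F := by
  simp only [pmfExp, ← ENNReal.tsum_mul_left, mul_left_comm]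

lemma pmfExp_bind (p : PMF α) (k : α → PMF β) (F : β → ℝ≥0∞) :
    pmfExp (p.bind k) F = pmfExp p fun x => pmfExp (k x) F := by
  simp only [pmfExp, PMF.bind_apply, ← ENNReal.tsum_mul_right, ← ENNReal.tsum_mul_left, mul_assoc]
  exact ENNReal.tsum_comm

lemma pmfExp_pure (a : α) (F : α → ℝ≥0∞) : pmfExp (PMF.pure a) F = F a := by
  rw [pmfExp, tsum_eq_single a fun b hb => by simp [PMF.pure_apply, hb]]
  simp

lemma pmfExp_map (p : PMF α) (f : α → β) (F : β → ℝ≥0∞) :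
    pmfExp (p.map f) F = pmfExp p fun x => F (f x) := by
  simp only [← PMF.bind_pure_comp, pmfExp_bind, Function.comp_apply, pmfExp_pure]

lemma eq_of_pmfExp_le {p : PMF α} {F G : α → ℝ≥0∞} (hF : pmfExp p F ≠ ∞)
    (hFG : ∀ x ∈ p.support, F x ≤ G x) (h : pmfExp p G ≤ pmfExp p F) {x : α}
    (hx : x ∈ p.support) : F x = G x := by
  by_contra hne
  have hle : ∀ y, p y * F y ≤ p y * G y := fun y => by
    by_cases hy : y ∈ p.support
    · exact mul_le_mul_right (hFG y hy) _
    · simp [(PMF.apply_eq_zero_iff p y).2 hy]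
  have hlt : p x * F x < p x * G x :=
    ENNReal.mul_lt_mul_right hx (p.apply_ne_top x) (lt_of_le_of_ne (hFG x hx) hne)
  exact (ENNReal.tsum_lt_tsum hF hle hlt).not_ge h

lemma pmf_eq_of_le {p q : PMF α} (h : ∀ x, p x ≤ q x) : p = q := by
  by_contra hne
  obtain ⟨x, hx⟩ : ∃ x, p x ≠ q x := by
    by_contra! hc
    exact hne (PMF.ext hc)
  have := ENNReal.tsum_lt_tsum (f := p) (g := q) (by simp [p.tsum_coe]) h
    (lt_of_le_of_ne (h x) hx)
  simp [p.tsum_coe, q.tsum_coe] at this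

end PmfExp

section Convergence

variable {α ι : Type*} {l : Filter ι} {L : ι → PMF α} {π : PMF α} {F : α → ℝ≥0∞}

lemma eventually_lt_pmfExp (hL : ∀ q, Tendsto (fun t => L t q) l (𝓝 (π q)))
    (hF : ∀ q, F q ≠ ∞) {c : ℝ≥0∞} (hc : c < pmfExp π F) : ∀ᶠ t in l, c < pmfExp (L t) F := by
  rw [pmfExp, ENNReal.tsum_eq_iSup_sum, lt_iSup_iff] at hc
  obtain ⟨T, hT⟩ := hc
  have hsum : Tendsto (fun t => ∑ q ∈ T, L t q * F q) l (𝓝 (∑ q ∈ T, π q * F q)) :=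
    tendsto_finsetSum _ fun q _ => ENNReal.Tendsto.mul_const (hL q) (Or.inr (hF q))
  exact (hsum.eventually_const_lt hT).mono fun t ht => ht.trans_le (ENNReal.sum_le_tsum T)

lemma pmfExp_le_of_tendsto [l.NeBot] (hL : ∀ q, Tendsto (fun t => L t q) l (𝓝 (π q)))
    (hF : ∀ q, F q ≠ ∞) {c : ι → ℝ≥0∞} {C : ℝ≥0∞} (hc : Tendsto c l (𝓝 C))
    (h : ∀ t, pmfExp (L t) F ≤ c t) : pmfExp π F ≤ C :=
  le_of_forall_lt_imp_le_of_dense fun _ hlt => ge_of_tendsto hc <|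
    (eventually_lt_pmfExp hL hF hlt).mono fun t ht => ht.le.trans (h t)

/-- Fatou's lemma is applied to `F` and to `B - F`. -/
lemma tendsto_pmfExp (hL : ∀ q, Tendsto (fun t => L t q) l (𝓝 (π q))) {B : ℝ≥0∞}
    (hB : B ≠ ∞) (hF : ∀ q, F q ≤ B) : Tendsto (fun t => pmfExp (L t) F) l (𝓝 (pmfExp π F)) := by
  have hcompl (p : PMF α) : pmfExp p (fun q => B - F q) + pmfExp p F = B := by
    simp only [← pmfExp_add, tsub_add_cancel_of_le (hF _), pmfExp_const]
  have hle (p : PMF α) : pmfExp p F ≤ B := le_add_self.trans (hcompl p).le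
  have hFfin (q : α) : F q ≠ ∞ := ne_top_of_le_ne_top hB (hF q)
  refine tendsto_order.2 ⟨fun c hc => eventually_lt_pmfExp hL hFfin hc, fun c hc => ?_⟩
  rcases lt_or_ge B c with hBc | hcB
  · exact .of_forall fun t => (hle _).trans_lt hBc
  have hsub : B - c < pmfExp π fun q => B - F q := by
    by_contra! hge
    have hsum : B ≤ B - c + pmfExp π F := (hcompl π).ge.trans (add_le_add_left hge _)
    exact hc.not_ge ((ENNReal.sub_sub_cancel hB hcB).ge.trans (tsub_le_iff_left.2 hsum))
  filter_upwards [eventually_lt_pmfExp hL (fun q => ENNReal.sub_ne_top hB) hsub] with t ht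
  by_contra! hge
  exact ht.not_ge <| (ENNReal.le_sub_of_add_le_right (ne_top_of_le_ne_top hB (hle _))
    (hcompl (L t)).le).trans (tsub_le_tsub_left hge B)

end Convergence

lemma limsup_pmfExp_le {α : Type*} (p : PMF α) {F : ℕ → α → ℝ≥0∞} {B : ℝ≥0∞} (hB : B ≠ ∞)
    (hF : ∀ t x, F t x ≤ B) :
    limsup (fun t => pmfExp p (F t)) atTop ≤ pmfExp p fun x => limsup (fun t => F t x) atTop := by
  let _ : MeasurableSpace α := ⊤
  have hp : ∑' x, p x * B ≠ ∞ := by rwa [← pmfExp, pmfExp_const]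
  simpa only [pmfExp, lintegral_count, ENNReal.limsup_const_mul_of_ne_top (p.apply_ne_top _)] using
    limsup_lintegral_le (μ := Measure.count) (f := fun t x => p x * F t x) (fun x => p x * B)
      (fun _ => measurable_from_top) (fun t => .of_forall fun x => mul_le_mul_right (hF t x) _)
      (by rwa [lintegral_count])

lemma one_le_sum_add_pmfExp_div {α : Type*} (p : PMF α) (g : α → ℝ≥0∞) {M : ℝ≥0∞} (hM₀ : M ≠ 0)
    (hM : M ≠ ∞) {T : Finset α} (hT : ∀ q ∉ T, M ≤ g q) :
    1 ≤ ∑ q ∈ T, p q + pmfExp p g / M := by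
  classical
  calc 1 = pmfExp p fun _ => 1 := (pmfExp_const p 1).symm
    _ ≤ pmfExp p fun q => (if q ∈ T then 1 else 0) + M⁻¹ * g q := by
        refine pmfExp_mono fun q _ => ?_
        by_cases hq : q ∈ T
        · simp [hq]
        · simpa [hq, ENNReal.inv_mul_cancel hM₀ hM] using mul_le_mul_right (hT q hq) M⁻¹
    _ = ∑ q ∈ T, p q + pmfExp p g / M := by
        rw [pmfExp_add, pmfExp_const_mul, div_eq_mul_inv, mul_comm (pmfExp p g), pmfExp,
          tsum_eq_sum (s := T) fun q hq => by simp [hq]]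
        exact congrArg (· + _) (Finset.sum_congr rfl fun q hq => by simp [hq])

lemma tendsto_const_div_nat_succ {c : ℝ≥0∞} (hc : c ≠ ∞) :
    Tendsto (fun n : ℕ => c / (n + 1 : ℕ)) atTop (𝓝 0) :=
  (ENNReal.Tendsto.const_div ENNReal.tendsto_nat_nhds_top (Or.inr hc)).comp
    (tendsto_add_atTop_nat 1) |>.trans (by simp)

/-- Prokhorov's theorem: a coercive `g` with bounded means keeps the mass from escaping. -/
lemma exists_tendsto_pmf_of_pmfExp_le {α ι : Type*} (l : Ultrafilter ι) {L : ι → PMF α}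
    {g : α → ℝ≥0∞} (hg : Tendsto g cofinite (𝓝 ∞)) {B : ℝ≥0∞} (hB : B ≠ ∞)
    (h : ∀ i, pmfExp (L i) g ≤ B) :
    ∃ π : PMF α, ∀ q, Tendsto (fun i => L i q) l (𝓝 (π q)) := by
  have hlim (q : α) : Tendsto (fun i => L i q) l (𝓝 (l.map fun i => L i q).lim) :=
    (l.map fun i => L i q).le_nhds_lim
  set c : α → ℝ≥0∞ := fun q => (l.map fun i => L i q).lim
  have hsum (T : Finset α) : Tendsto (fun i => ∑ q ∈ T, L i q) l (𝓝 (∑ q ∈ T, c q)) :=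
    tendsto_finsetSum _ fun q _ => hlim q
  have hle : ∑' q, c q ≤ 1 := by
    rw [ENNReal.tsum_eq_iSup_sum]
    exact iSup_le fun T => le_of_tendsto' (hsum T) fun i =>
      (ENNReal.sum_le_tsum T).trans (L i).tsum_coe.le
  have hge (M : ℕ) : 1 ≤ ∑' q, c q + B / (M + 1 : ℕ) := by
    have hfin : {q | ¬ ((M + 1 : ℕ) : ℝ≥0∞) ≤ g q}.Finite :=
      eventually_cofinite.1 (hg.eventually_const_le (ENNReal.natCast_lt_top _))
    have hT (i : ι) : 1 ≤ ∑ q ∈ hfin.toFinset, L i q + B / (M + 1 : ℕ) :=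
      (one_le_sum_add_pmfExp_div (L i) g (by simp) (ENNReal.natCast_ne_top _)
        (by simp)).trans (add_le_add_right (ENNReal.div_le_div_right (h i) _) _)
    exact (ge_of_tendsto' ((hsum _).add_const _) hT).trans
      (add_le_add_left (ENNReal.sum_le_tsum _) _)
  have hdiv : Tendsto (fun M : ℕ => ∑' q, c q + B / (M + 1 : ℕ)) atTop (𝓝 (∑' q, c q + 0)) :=
    tendsto_const_nhds.add (tendsto_const_div_nat_succ hB)
  have hone : ∑' q, c q = 1 := hle.antisymm (by simpa using ge_of_tendsto' hdiv hge)
  exact ⟨⟨c, hone ▸ ENNReal.summable.hasSum⟩, hlim⟩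

/-- The law at time `t` of the Markov chain with transition probabilities `P` and initial
law `μ`. -/
noncomputable def markovLaw {S : Type*} (P : S → PMF S) (μ : PMF S) : ℕ → PMF S
  | 0 => μ
  | t + 1 => (markovLaw P μ t).bind P

/-- The law of a Markov chain at a time drawn uniformly from `0, …, n`. -/
noncomputable def cesaroLaw {S : Type*} (P : S → PMF S) (μ : PMF S) (n : ℕ) : PMF S :=
  (PMF.uniformOfFintype (Fin (n + 1))).bind fun t => markovLaw P μ t

/-- Foster's drift condition for the chain `P`: the mean of `f` changes by at most `b - g x` in a
step from `x`. -/
def HasDrift {S : Type*} (P : S → PMF S) (f g : S → ℝ≥0∞) (b : ℝ≥0∞) : Prop :=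
  ∀ x, pmfExp (P x) f + g x ≤ f x + b

/-- A function whose mean does not decrease along the chain `P`. -/
def IsSubharmonic {S : Type*} (P : S → PMF S) (k : S → ℝ≥0∞) : Prop :=
  ∀ x, k x ≤ pmfExp (P x) k

section MarkovChain

variable {S : Type*} {P : S → PMF S} {μ π : PMF S}

lemma markovLaw_bind {T : Type*} (P : S → PMF S) (μ : PMF T) (κ : T → PMF S) (t : ℕ) :
    markovLaw P (μ.bind κ) t = μ.bind fun x => markovLaw P (κ x) t := by
  induction t with
  | zero => rfl
  | succ t ih => simp only [markovLaw, ih, PMF.bind_bind]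

lemma markovLaw_succ (P : S → PMF S) (μ : PMF S) (t : ℕ) :
    markovLaw P μ (t + 1) = markovLaw P (μ.bind P) t := by
  induction t with
  | zero => rfl
  | succ t ih => rw [markovLaw, ih, markovLaw]

lemma markovLaw_of_invariant (h : π.bind P = π) (t : ℕ) : markovLaw P π t = π := by
  induction t with
  | zero => rfl
  | succ t ih => rw [markovLaw, ih, h]

lemma markovLaw_apply (P : S → PMF S) (μ : PMF S) (t : ℕ) (q : S) :
    markovLaw P μ t q = pmfExp μ fun x => markovLaw P (PMF.pure x) t q := by
  conv_lhs => rw [← PMF.bind_pure μ, markovLaw_bind]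
  rw [PMF.bind_apply, pmfExp]

lemma pmfExp_cesaroLaw (P : S → PMF S) (μ : PMF S) (n : ℕ) (F : S → ℝ≥0∞) :
    pmfExp (cesaroLaw P μ n) F =
      (∑ t ∈ Finset.range (n + 1), pmfExp (markovLaw P μ t) F) / (n + 1 : ℕ) := by
  rw [cesaroLaw, pmfExp_bind, pmfExp, tsum_fintype, Finset.sum_range, div_eq_mul_inv, mul_comm,
    Finset.mul_sum]
  simp only [PMF.uniformOfFintype_apply, Fintype.card_fin]

lemma cesaroLaw_apply (P : S → PMF S) (μ : PMF S) (n : ℕ) (q : S) :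
    cesaroLaw P μ n q = (∑ t ∈ Finset.range (n + 1), markovLaw P μ t q) / (n + 1 : ℕ) := by
  rw [cesaroLaw, PMF.bind_apply, tsum_fintype, Finset.sum_range, div_eq_mul_inv, mul_comm,
    Finset.mul_sum]
  simp only [PMF.uniformOfFintype_apply, Fintype.card_fin]

lemma cesaroLaw_bind_apply_le (P : S → PMF S) (μ : PMF S) (n : ℕ) (q : S) :
    (cesaroLaw P μ n).bind P q ≤ cesaroLaw P μ n q + 1 / (n + 1 : ℕ) := by
  have hbind : (cesaroLaw P μ n).bind P q =
      (∑ t ∈ Finset.range (n + 1), markovLaw P μ (t + 1) q) / (n + 1 : ℕ) := by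
    rw [PMF.bind_apply, ← pmfExp, pmfExp_cesaroLaw]
    simp only [markovLaw, PMF.bind_apply, pmfExp]
  rw [hbind, cesaroLaw_apply, ← ENNReal.add_div]
  gcongr
  calc ∑ t ∈ Finset.range (n + 1), markovLaw P μ (t + 1) q
      ≤ ∑ t ∈ Finset.range (n + 2), markovLaw P μ t q := by
        rw [Finset.sum_range_succ' _ (n + 1)]
        exact le_self_add
    _ ≤ ∑ t ∈ Finset.range (n + 1), markovLaw P μ t q + 1 := by
        rw [Finset.sum_range_succ]
        exact add_le_add_right (PMF.coe_le_one _ _) _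

lemma tendsto_cesaroLaw (hπ : ∀ q, Tendsto (fun t => markovLaw P μ t q) atTop (𝓝 (π q))) (q : S) :
    Tendsto (fun n => cesaroLaw P μ n q) atTop (𝓝 (π q)) := by
  have hreal : Tendsto (fun t => (markovLaw P μ t q).toReal) atTop (𝓝 (π q).toReal) :=
    (ENNReal.tendsto_toReal (π.apply_ne_top q)).comp (hπ q)
  rw [← ENNReal.tendsto_toReal_iff (fun n => PMF.apply_ne_top _ q) (π.apply_ne_top q)]
  refine (hreal.cesaro.comp (tendsto_add_atTop_nat 1)).congr fun n => ?_
  rw [cesaroLaw_apply, ENNReal.toReal_div, ENNReal.toReal_sum fun t _ => PMF.apply_ne_top _ q,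
    ENNReal.toReal_natCast, div_eq_inv_mul, Function.comp_apply]

variable {f g : S → ℝ≥0∞} {b : ℝ≥0∞}

lemma HasDrift.pmfExp_add_le (h : HasDrift P f g b) (μ : PMF S) :
    pmfExp (μ.bind P) f + pmfExp μ g ≤ pmfExp μ f + b := by
  rw [pmfExp_bind, ← pmfExp_add]
  conv_rhs => rw [← pmfExp_const μ b, ← pmfExp_add]
  exact pmfExp_mono fun x _ => h x

lemma HasDrift.sum_le (h : HasDrift P f g b) (μ : PMF S) (T : ℕ) :
    pmfExp (markovLaw P μ T) f + ∑ t ∈ Finset.range T, pmfExp (markovLaw P μ t) g ≤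
      pmfExp μ f + T * b := by
  induction T with
  | zero => simp [markovLaw]
  | succ T ih =>
    calc pmfExp (markovLaw P μ (T + 1)) f + ∑ t ∈ Finset.range (T + 1), pmfExp (markovLaw P μ t) g
        = (pmfExp ((markovLaw P μ T).bind P) f + pmfExp (markovLaw P μ T) g) +
            ∑ t ∈ Finset.range T, pmfExp (markovLaw P μ t) g := by
          rw [Finset.sum_range_succ, markovLaw]
          ring
      _ ≤ (pmfExp (markovLaw P μ T) f + b) +
            ∑ t ∈ Finset.range T, pmfExp (markovLaw P μ t) g := by
          exact add_le_add_left (h.pmfExp_add_le _) _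
      _ = (pmfExp (markovLaw P μ T) f + ∑ t ∈ Finset.range T, pmfExp (markovLaw P μ t) g) + b := by
          ring
      _ ≤ (pmfExp μ f + T * b) + b := by gcongr
      _ = pmfExp μ f + (T + 1 : ℕ) * b := by
          push_cast
          ring

lemma HasDrift.pmfExp_cesaroLaw_le (h : HasDrift P f g b) (μ : PMF S) (n : ℕ) :
    pmfExp (cesaroLaw P μ n) g ≤ pmfExp μ f / (n + 1 : ℕ) + b := by
  rw [pmfExp_cesaroLaw]
  refine (ENNReal.div_le_div_right (le_add_self.trans (h.sum_le μ (n + 1))) _).trans_eq ?_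
  rw [ENNReal.add_div, mul_comm, ENNReal.mul_div_cancel_right (by simp)
    (ENNReal.natCast_ne_top _)]

lemma HasDrift.pmfExp_le (h : HasDrift P f g b) (hg : ∀ x, g x ≠ ∞) (hf : pmfExp μ f ≠ ∞)
    (hπ : ∀ q, Tendsto (fun t => markovLaw P μ t q) atTop (𝓝 (π q))) : pmfExp π g ≤ b :=
  pmfExp_le_of_tendsto (tendsto_cesaroLaw hπ) hg
    (by simpa using (tendsto_const_div_nat_succ hf).add_const b) (h.pmfExp_cesaroLaw_le μ)

/-- Krylov–Bogolyubov: by the drift condition the time averages are tight, and their limits are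
invariant. -/
lemma HasDrift.exists_invariant (h : HasDrift P f g b) (hb : b ≠ ∞)
    (hg : Tendsto g cofinite (𝓝 ∞)) (hf : pmfExp μ f ≠ ∞) :
    ∃ π : PMF S, π.bind P = π ∧
      ∀ q, Tendsto (fun n => cesaroLaw P μ n q) (hyperfilter ℕ) (𝓝 (π q)) := by
  have hbound (n : ℕ) : pmfExp (cesaroLaw P μ n) g ≤ pmfExp μ f + b :=
    (h.pmfExp_cesaroLaw_le μ n).trans <|
      add_le_add_left (ENNReal.div_le_of_le_mul (le_mul_of_one_le_right' (by simp))) _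
  obtain ⟨π, hπ⟩ := exists_tendsto_pmf_of_pmfExp_le (hyperfilter ℕ) hg
    (ENNReal.add_ne_top.2 ⟨hf, hb⟩) hbound
  refine ⟨π, pmf_eq_of_le fun q => ?_, hπ⟩
  have herror : Tendsto (fun n : ℕ => 1 / ((n + 1 : ℕ) : ℝ≥0∞)) (hyperfilter ℕ) (𝓝 0) :=
    (tendsto_const_div_nat_succ ENNReal.one_ne_top).mono_left Nat.hyperfilter_le_atTop
  have hstep (n : ℕ) := cesaroLaw_bind_apply_le P μ n q
  simp only [PMF.bind_apply] at hstep ⊢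
  exact pmfExp_le_of_tendsto hπ (fun x => PMF.apply_ne_top _ _)
    (by simpa only [add_zero] using (hπ q).add herror) hstep

variable {k : S → ℝ≥0∞}

lemma IsSubharmonic.sup_const (hk : IsSubharmonic P k) (c : ℝ≥0∞) :
    IsSubharmonic P fun x => k x ⊔ c := fun x =>
  sup_le ((hk x).trans (pmfExp_mono fun _ _ => le_sup_left))
    ((pmfExp_const (P x) c).ge.trans (pmfExp_mono fun _ _ => le_sup_right))

lemma IsSubharmonic.pmfExp_le_markovLaw (hk : IsSubharmonic P k) (μ : PMF S) (t : ℕ) :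
    pmfExp μ k ≤ pmfExp (markovLaw P μ t) k := by
  induction t with
  | zero => exact le_rfl
  | succ t ih =>
    rw [markovLaw, pmfExp_bind]
    exact ih.trans (pmfExp_mono fun x _ => hk x)

lemma IsSubharmonic.pmfExp_le_cesaroLaw (hk : IsSubharmonic P k) (μ : PMF S) (n : ℕ) :
    pmfExp μ k ≤ pmfExp (cesaroLaw P μ n) k := by
  rw [cesaroLaw, pmfExp_bind, ← pmfExp_const (PMF.uniformOfFintype (Fin (n + 1))) (pmfExp μ k)]
  exact pmfExp_mono fun t _ => hk.pmfExp_le_markovLaw μ t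

lemma IsSubharmonic.eq_pmfExp (hk : IsSubharmonic P k) (hπ : π.bind P = π)
    (hfin : pmfExp π k ≠ ∞) {x : S} (hx : x ∈ π.support) : k x = pmfExp (P x) k :=
  eq_of_pmfExp_le hfin (fun x _ => hk x) (by rw [← pmfExp_bind, hπ]) hx

/-- Since `k ⊔ k x` is harmonic `π`-almost everywhere as well and takes its least value at `x`, it
is constant on the successors of `x`. -/
lemma IsSubharmonic.eq_of_mem_support (hk : IsSubharmonic P k) (hπ : π.bind P = π) {B : ℝ≥0∞}
    (hB : B ≠ ∞) (hkB : ∀ x, k x ≤ B) {x y : S} (hx : x ∈ π.support) (hy : y ∈ (P x).support) :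
    k y = k x := by
  have hfin {h : S → ℝ≥0∞} (hle : ∀ x, h x ≤ B) (p : PMF S) : pmfExp p h ≠ ∞ :=
    ne_top_of_le_ne_top hB ((pmfExp_mono fun x _ => hle x).trans_eq (pmfExp_const p B))
  have hmax := (hk.sup_const (k x)).eq_pmfExp hπ (hfin (fun z => sup_le (hkB z) (hkB x)) π) hx
  have hle : ∀ z ∈ (P x).support, k z ≤ k x := fun z hz =>
    sup_eq_right.1 <| .symm <| eq_of_pmfExp_le (F := fun _ => k x) (G := fun z => k z ⊔ k x)
      (hfin (fun _ => hkB x) _) (fun _ _ => le_sup_right)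
      (by simpa only [sup_idem, pmfExp_const] using hmax.ge) hz
  exact eq_of_pmfExp_le (G := fun _ => k x) (hfin hkB _) hle
    ((pmfExp_const _ _).le.trans (hk x)) hy

/-- The height `ℓ` drives the chain from every state to `o` with positive probability. -/
lemma IsSubharmonic.eq_on_support (hk : IsSubharmonic P k) (hπ : π.bind P = π) {B : ℝ≥0∞}
    (hB : B ≠ ∞) (hkB : ∀ x, k x ≤ B) {o : S} {ℓ : S → ℕ}
    (hℓ : ∀ x ≠ o, ∃ y ∈ (P x).support, ℓ y < ℓ x) {x : S} (hx : x ∈ π.support) : k x = k o := by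
  induction hn : ℓ x using Nat.strong_induction_on generalizing x with
  | _ n ih =>
    rcases eq_or_ne x o with rfl | hne
    · rfl
    · obtain ⟨y, hy, hlt⟩ := hℓ x hne
      have hyπ : y ∈ π.support := hπ ▸ (PMF.mem_support_bind_iff _ _ _).2 ⟨x, hx, hy⟩
      exact (hk.eq_of_mem_support hπ hB hkB hx hy).symm.trans (ih (ℓ y) (hn ▸ hlt) hyπ rfl)

lemma HasDrift.le_of_isSubharmonic (h : HasDrift P f g b) (hb : b ≠ ∞)
    (hg : Tendsto g cofinite (𝓝 ∞)) (hf : ∀ x, f x ≠ ∞) (hk : IsSubharmonic P k) {B : ℝ≥0∞}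
    (hB : B ≠ ∞) (hkB : ∀ x, k x ≤ B) {o : S} {ℓ : S → ℕ}
    (hℓ : ∀ x ≠ o, ∃ y ∈ (P x).support, ℓ y < ℓ x) (x : S) : k x ≤ k o := by
  obtain ⟨π, hπ, hlim⟩ := h.exists_invariant (μ := PMF.pure x) hb hg
    (by simpa only [pmfExp_pure] using hf x)
  calc k x ≤ pmfExp π k := ge_of_tendsto' (tendsto_pmfExp hlim hB hkB) fun n => by
        simpa only [pmfExp_pure] using hk.pmfExp_le_cesaroLaw (PMF.pure x) n
    _ = pmfExp π fun _ => k o := pmfExp_congr fun y hy => hk.eq_on_support hπ hB hkB hℓ hy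
    _ = k o := pmfExp_const _ _

end MarkovChain

/-- The law of a pair of independent variables with laws `μ` and `ν`. -/
noncomputable def pmfProd {S : Type*} (μ ν : PMF S) : PMF (S × S) :=
  μ.bind fun x => ν.map (Prod.mk x)

/-- The transition probabilities of two independent copies of the chain `P`. -/
noncomputable def prodKernel {S : Type*} (P : S → PMF S) (z : S × S) : PMF (S × S) :=
  pmfProd (P z.1) (P z.2)

section ProductChain

variable {S : Type*} {P : S → PMF S} {f g : S → ℝ≥0∞} {b : ℝ≥0∞}

lemma pmfExp_pmfProd_add (μ ν : PMF S) (F G : S → ℝ≥0∞) :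
    pmfExp (pmfProd μ ν) (fun z => F z.1 + G z.2) = pmfExp μ F + pmfExp ν G := by
  simp only [pmfProd, pmfExp_bind, pmfExp_map, pmfExp_add, pmfExp_const]

lemma pmfExp_sub_le (μ ν : PMF S) (F G : S → ℝ≥0∞) :
    pmfExp μ F - pmfExp ν G ≤ pmfExp (pmfProd μ ν) fun z => F z.1 - G z.2 := by
  have hF := pmfExp_pmfProd_add μ ν F fun _ => 0
  have hG := pmfExp_pmfProd_add μ ν (fun _ => 0) G
  simp only [pmfExp_const, add_zero, zero_add] at hF hG
  rw [tsub_le_iff_right, ← hF, ← hG, ← pmfExp_add]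
  exact pmfExp_mono fun z _ => le_tsub_add

lemma mem_support_pmfProd {μ ν : PMF S} {x y : S} (hx : x ∈ μ.support) (hy : y ∈ ν.support) :
    (x, y) ∈ (pmfProd μ ν).support :=
  (PMF.mem_support_bind_iff _ _ _).2 ⟨x, hx, (PMF.mem_support_map_iff _ _ _).2 ⟨y, hy, rfl⟩⟩

lemma HasDrift.prod (h : HasDrift P f g b) :
    HasDrift (prodKernel P) (fun z => f z.1 + f z.2) (fun z => g z.1 + g z.2) (b + b) := fun z => by
  rw [prodKernel, pmfExp_pmfProd_add, add_add_add_comm, add_add_add_comm (f z.1)]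
  exact add_le_add (h z.1) (h z.2)

lemma tendsto_add_cofinite_prod (hg : Tendsto g cofinite (𝓝 ∞)) :
    Tendsto (fun z : S × S => g z.1 + g z.2) cofinite (𝓝 ∞) := by
  rw [← coprod_cofinite, Filter.coprod, tendsto_sup]
  exact ⟨tendsto_nhds_top_mono' (hg.comp tendsto_comap) fun _ => le_self_add,
    tendsto_nhds_top_mono' (hg.comp tendsto_comap) fun _ => le_add_self⟩

lemma exists_mem_support_prodKernel_lt {o : S} {ℓ : S → ℕ} (ho : o ∈ (P o).support)
    (hℓ : ∀ x ≠ o, ∃ y ∈ (P x).support, ℓ y < ℓ x) {z : S × S} (hz : z ≠ (o, o)) :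
    ∃ w ∈ (prodKernel P z).support, ℓ w.1 + ℓ w.2 < ℓ z.1 + ℓ z.2 := by
  have hle (x : S) : ∃ y ∈ (P x).support, ℓ y ≤ ℓ x := by
    rcases eq_or_ne x o with rfl | hx
    · exact ⟨x, ho, le_rfl⟩
    · exact (hℓ x hx).imp fun y hy => ⟨hy.1, hy.2.le⟩
  obtain ⟨y₁, hy₁, h₁⟩ := hle z.1
  obtain ⟨y₂, hy₂, h₂⟩ := hle z.2
  rcases eq_or_ne z.1 o with hz₁ | hz₁
  · obtain ⟨y, hy, hlt⟩ := hℓ z.2 fun hz₂ => hz (Prod.ext hz₁ hz₂)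
    exact ⟨(y₁, y), mem_support_pmfProd hy₁ hy, add_lt_add_of_le_of_lt h₁ hlt⟩
  · obtain ⟨y, hy, hlt⟩ := hℓ z.1 hz₁
    exact ⟨(y, y₂), mem_support_pmfProd hy hy₂, add_lt_add_of_lt_of_le hlt h₂⟩

lemma isSubharmonic_limsup_sub (P : S → PMF S) (q : S) :
    IsSubharmonic (prodKernel P) fun z => limsup
      (fun t => markovLaw P (PMF.pure z.1) t q - markovLaw P (PMF.pure z.2) t q) atTop := by
  intro z
  dsimp only
  rw [← limsup_nat_add _ 1]
  refine le_trans (limsup_le_limsup (.of_forall fun t => ?_)) <| limsup_pmfExp_le (prodKernel P z)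
    (F := fun t z => markovLaw P (PMF.pure z.1) t q - markovLaw P (PMF.pure z.2) t q)
    ENNReal.one_ne_top fun t z => tsub_le_self.trans (PMF.coe_le_one _ _)
  simp only [markovLaw_succ, PMF.pure_bind]
  rw [markovLaw_apply P (P z.1), markovLaw_apply P (P z.2)]
  exact pmfExp_sub_le _ _ _ _

/-- The chain forgets its initial law: for two independent copies, the asymptotic difference of
their transition probabilities is subharmonic and vanishes at the diagonal point `(o, o)`. -/
lemma HasDrift.limsup_sub_eq_zero (h : HasDrift P f g b) (hb : b ≠ ∞)
    (hg : Tendsto g cofinite (𝓝 ∞)) (hf : ∀ x, f x ≠ ∞) {o : S} {ℓ : S → ℕ}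
    (ho : o ∈ (P o).support) (hℓ : ∀ x ≠ o, ∃ y ∈ (P x).support, ℓ y < ℓ x) (μ ν : PMF S) (q : S) :
    limsup (fun t => markovLaw P μ t q - markovLaw P ν t q) atTop = 0 := by
  have hone (t : ℕ) (z : S × S) :
      markovLaw P (PMF.pure z.1) t q - markovLaw P (PMF.pure z.2) t q ≤ 1 :=
    tsub_le_self.trans (PMF.coe_le_one _ _)
  have hzero (z : S × S) :
      limsup (fun t => markovLaw P (PMF.pure z.1) t q - markovLaw P (PMF.pure z.2) t q) atTop =
        0 := by
    refine le_bot_iff.1 <| (h.prod.le_of_isSubharmonic (ENNReal.add_ne_top.2 ⟨hb, hb⟩)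
      (tendsto_add_cofinite_prod hg) (fun z => ENNReal.add_ne_top.2 ⟨hf z.1, hf z.2⟩)
      (isSubharmonic_limsup_sub P q) ENNReal.one_ne_top (fun z => limsup_le_of_le
        (h := .of_forall fun t => hone t z)) (o := (o, o)) (ℓ := fun z => ℓ z.1 + ℓ z.2)
      (fun z hz => exists_mem_support_prodKernel_lt ho hℓ hz) z).trans ?_
    simp
  refine le_bot_iff.1 ?_
  calc limsup (fun t => markovLaw P μ t q - markovLaw P ν t q) atTop
      ≤ limsup (fun t => pmfExp (pmfProd μ ν) fun z =>
          markovLaw P (PMF.pure z.1) t q - markovLaw P (PMF.pure z.2) t q) atTop := by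
        refine limsup_le_limsup (.of_forall fun t => ?_)
        dsimp only
        rw [markovLaw_apply P μ, markovLaw_apply P ν]
        exact pmfExp_sub_le _ _ _ _
    _ ≤ pmfExp (pmfProd μ ν) fun _ => 0 := by
        simpa only [hzero] using limsup_pmfExp_le (pmfProd μ ν) ENNReal.one_ne_top hone
    _ = 0 := pmfExp_const _ _

theorem HasDrift.exists_tendsto (h : HasDrift P f g b) (hb : b ≠ ∞)
    (hg : Tendsto g cofinite (𝓝 ∞)) (hf : ∀ x, f x ≠ ∞) {o : S} {ℓ : S → ℕ}
    (ho : o ∈ (P o).support) (hℓ : ∀ x ≠ o, ∃ y ∈ (P x).support, ℓ y < ℓ x) :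
    ∃ π : PMF S, ∀ μ q, Tendsto (fun t => markovLaw P μ t q) atTop (𝓝 (π q)) := by
  obtain ⟨π, hπ, -⟩ := h.exists_invariant (μ := PMF.pure o) hb hg
    (by simpa only [pmfExp_pure] using hf o)
  refine ⟨π, fun μ q => (ENNReal.tendsto_nhds (π.apply_ne_top q)).2 fun ε hε => ?_⟩
  have hclose (μ ν : PMF S) : ∀ᶠ t in atTop, markovLaw P μ t q - markovLaw P ν t q < ε :=
    eventually_lt_of_limsup_lt ((h.limsup_sub_eq_zero hb hg hf ho hℓ μ ν q).trans_lt hε)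
  filter_upwards [hclose μ π, hclose π μ] with t hle hge
  rw [markovLaw_of_invariant hπ] at hle hge
  exact ⟨tsub_le_iff_tsub_le.1 hge.le, tsub_le_iff_left.1 hle.le⟩

end ProductChain

section Integral

variable {S : Type*} [Countable S] [MeasurableSpace S] [MeasurableSingletonClass S]

lemma lintegral_toMeasure_eq_pmfExp (p : PMF S) (F : S → ℝ≥0∞) :
    ∫⁻ x, F x ∂p.toMeasure = pmfExp p F := by
  rw [lintegral_countable', pmfExp]
  exact tsum_congr fun x => by
    rw [p.toMeasure_apply_singleton x (measurableSet_singleton x), mul_comm]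

lemma ae_toMeasure_iff (p : PMF S) {Q : S → Prop} :
    (∀ᵐ x ∂p.toMeasure, Q x) ↔ ∀ x ∈ p.support, Q x := by
  rw [ae_iff, p.toMeasure_apply_eq_zero_iff (Set.to_countable _).measurableSet,
    Set.disjoint_right]
  exact forall_congr' fun x => by
    rw [Set.mem_ofPred_eq, not_imp_comm, not_not]

lemma integrable_toMeasure_of_abs_le (p : PMF S) {f : S → ℝ} (C : ℝ)
    (h : ∀ x ∈ p.support, |f x| ≤ C) : Integrable f p.toMeasure :=
  .of_bound (measurable_of_countable f).aestronglyMeasurable C ((ae_toMeasure_iff p).2 h)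

lemma abs_integral_toMeasure_le (p : PMF S) {f : S → ℝ} {C : ℝ}
    (h : ∀ x ∈ p.support, |f x| ≤ C) : |∫ x, f x ∂p.toMeasure| ≤ C := by
  simpa using norm_integral_le_of_norm_le_const (f := f) ((ae_toMeasure_iff p).2 h)

lemma pmfExp_ofReal (p : PMF S) {f : S → ℝ} (hf : Integrable f p.toMeasure) (h0 : ∀ x, 0 ≤ f x) :
    pmfExp p (fun x => ENNReal.ofReal (f x)) = ENNReal.ofReal (∫ x, f x ∂p.toMeasure) := by
  rw [ofReal_integral_eq_lintegral_ofReal hf (.of_forall h0), lintegral_toMeasure_eq_pmfExp]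

lemma integrable_of_pmfExp_ne_top (p : PMF S) {f : S → ℝ} (h0 : ∀ x, 0 ≤ f x)
    (h : pmfExp p (fun x => ENNReal.ofReal (f x)) ≠ ∞) : Integrable f p.toMeasure := by
  refine ⟨(measurable_of_countable f).aestronglyMeasurable, ?_⟩
  rw [hasFiniteIntegral_iff_ofReal (.of_forall h0), lintegral_toMeasure_eq_pmfExp]
  exact h.lt_top

end Integral

/-- The number of packets at input port `i`, or the number of arrivals to it. -/
def rowSum {n : ℕ} (i : Fin n) (x : SwitchMat n) : ℕ := ∑ j, x i j

/-- The queue lengths after a slot with arrivals `a` and schedule `s`. -/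
def nextQueue {n : ℕ} (x a s : SwitchMat n) : SwitchMat n := fun i j => x i j + a i j - s i j

section ArrivalLaw

variable {n : ℕ} {A : PMF (SwitchMat n)} {amax : ℕ} {lam : Fin n → Fin n → ℝ}

lemma IsArrivalLaw.finite_support (hA : IsArrivalLaw A amax lam) : A.support.Finite :=
  (Set.Finite.pi' fun _ => Set.Finite.pi' fun _ => Set.finite_Iic amax).subset
    fun a ha i j => hA.bounded a ha i j

lemma IsArrivalLaw.integrable (hA : IsArrivalLaw A amax lam) (f : SwitchMat n → ℝ) :
    Integrable f A.toMeasure := by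
  obtain ⟨C, hC⟩ := (hA.finite_support.image fun x => |f x|).bddAbove
  exact integrable_toMeasure_of_abs_le A C fun x hx => hC ⟨x, hx, rfl⟩

lemma IsArrivalLaw.rowSum_le (hA : IsArrivalLaw A amax lam) {a : SwitchMat n}
    (ha : a ∈ A.support) (i : Fin n) : rowSum i a ≤ n * amax :=
  (Finset.sum_le_sum fun j _ => hA.bounded a ha i j).trans_eq (by simp)

lemma IsArrivalLaw.integral_rowSum (hA : IsArrivalLaw A amax lam) (i : Fin n) :
    ∫ a, (rowSum i a : ℝ) ∂A.toMeasure = ∑ j, lam i j := by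
  simp only [rowSum, Nat.cast_sum]
  rw [integral_finsetSum _ fun j _ => hA.integrable _]
  exact Finset.sum_congr rfl fun j _ => hA.mean i j

lemma IsArrivalLaw.variance_rowSum (hA : IsArrivalLaw A amax lam) (i : Fin n) :
    variance (fun a : SwitchMat n => (rowSum i a : ℝ)) A.toMeasure = ∑ j, arrivalVar A i j := by
  have hmeas : Measurable fun m : ℕ => (m : ℝ) := measurable_of_countable _
  have hsum := IndepFun.variance_sum (μ := A.toMeasure) (s := Finset.univ)
    (X := fun (j : Fin n) (a : SwitchMat n) => (a i j : ℝ))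
    (fun j _ => (memLp_two_iff_integrable_sq
      (measurable_of_countable _).aestronglyMeasurable).2 (hA.integrable _))
    fun j _ k _ hjk => (hA.indep.indepFun (i := (i, j)) (j := (i, k))
      (by simpa using hjk)).comp hmeas hmeas
  refine Eq.trans (congrArg (variance · A.toMeasure) (funext fun a => ?_)) hsum
  simp only [rowSum, Nat.cast_sum, Finset.sum_apply]

lemma IsArrivalLaw.integral_rowSum_sq (hA : IsArrivalLaw A amax lam) (i : Fin n) :
    ∫ a, (rowSum i a : ℝ) ^ 2 ∂A.toMeasure = ∑ j, arrivalVar A i j + (∑ j, lam i j) ^ 2 := by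
  have hvar := variance_eq_sub <| (memLp_two_iff_integrable_sq (measurable_of_countable
    fun a : SwitchMat n => (rowSum i a : ℝ)).aestronglyMeasurable).2 (hA.integrable _)
  rw [hA.variance_rowSum, hA.integral_rowSum] at hvar
  exact (sub_eq_iff_eq_add.1 hvar.symm)

lemma IsArrivalLaw.integral_const_add (hA : IsArrivalLaw A amax lam) (c : ℝ)
    (f : SwitchMat n → ℝ) : ∫ a, (c + f a) ∂A.toMeasure = c + ∫ a, f a ∂A.toMeasure := by
  rw [integral_add (integrable_const c) (hA.integrable f), integral_const, probReal_univ, one_smul]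

end ArrivalLaw

section AnyPolicy

variable {n : ℕ} {A : PMF (SwitchMat n)} {p : SchedulingPolicy n} {init π : PMF (SwitchMat n)}

lemma meanQueue_eq_pmfExp (π : PMF (SwitchMat n)) (i j : Fin n) :
    meanQueue π i j = pmfExp π fun q => (q i j : ℝ≥0∞) :=
  lintegral_toMeasure_eq_pmfExp _ _

lemma meanRowQueue_eq_pmfExp (π : PMF (SwitchMat n)) (i : Fin n) :
    meanRowQueue π i = pmfExp π fun q => ENNReal.ofReal (rowSum i q) := by
  simp only [meanRowQueue, lintegral_toMeasure_eq_pmfExp, ENNReal.ofReal_natCast]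
  simp only [rowSum, Nat.cast_sum]

lemma pmfExp_queueLaw (A : PMF (SwitchMat n)) (p : SchedulingPolicy n) (init : PMF (SwitchMat n))
    (t : ℕ) (F : SwitchMat n → ℝ≥0∞) :
    pmfExp (queueLaw A p init t) F = pmfExp (historyLaw A p init t) fun h => F h.1 :=
  pmfExp_map _ _ _

lemma pmfExp_queueLaw_succ (A : PMF (SwitchMat n)) (p : SchedulingPolicy n)
    (init : PMF (SwitchMat n)) (t : ℕ) (F : SwitchMat n → ℝ≥0∞) :
    pmfExp (queueLaw A p init (t + 1)) F = pmfExp (historyLaw A p init t) fun h =>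
      pmfExp (p.choose h) fun s => pmfExp A fun a => F (nextQueue h.1 a s) := by
  rw [pmfExp_queueLaw, historyLaw, pmfExp_bind]
  simp only [switchStep, pmfExp_bind, pmfExp_map]
  rfl

lemma IsSchedule.rowSum_le_nextQueue {s : SwitchMat n} (hs : IsSchedule s) (i : Fin n)
    (x a : SwitchMat n) : rowSum i x + rowSum i a - 1 ≤ rowSum i (nextQueue x a s) := by
  have hservice : rowSum i s ≤ 1 := hs.1 i
  have hbalance : rowSum i x + rowSum i a ≤ rowSum i (nextQueue x a s) + rowSum i s := by
    simp only [rowSum, nextQueue, ← Finset.sum_add_distrib]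
    exact Finset.sum_le_sum fun j _ => le_tsub_add
  lia

/-- Whatever the policy, an input port is served at most as fast as a single-server queue. -/
lemma pmfExp_le_pmfExp_queueLaw_succ (A : PMF (SwitchMat n)) (p : SchedulingPolicy n)
    (init : PMF (SwitchMat n)) (t : ℕ) (i : Fin n) {f : ℕ → ℝ≥0∞} (hf : Monotone f) :
    pmfExp (queueLaw A p init t) (fun q => pmfExp A fun a => f (rowSum i q + rowSum i a - 1)) ≤
      pmfExp (queueLaw A p init (t + 1)) fun q => f (rowSum i q) := by
  rw [pmfExp_queueLaw_succ, pmfExp_queueLaw]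
  refine pmfExp_mono fun h _ => ?_
  rw [← pmfExp_const (p.choose h) (pmfExp A fun a => f (rowSum i h.1 + rowSum i a - 1))]
  exact pmfExp_mono fun s hs => pmfExp_mono fun a _ =>
    hf ((p.feasible h s hs).rowSum_le_nextQueue i h.1 a)

lemma QueueConvergesTo.pmfExp_le (h : QueueConvergesTo A p init π) (i : Fin n) {f : ℕ → ℝ≥0∞}
    (hf : Monotone f) {B : ℝ≥0∞} (hB : B ≠ ∞) (hfB : ∀ k, f k ≤ B) :
    pmfExp π (fun q => pmfExp A fun a => f (rowSum i q + rowSum i a - 1)) ≤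
      pmfExp π fun q => f (rowSum i q) :=
  le_of_tendsto_of_tendsto'
    (tendsto_pmfExp h hB fun _ => (pmfExp_mono fun _ _ => hfB _).trans_eq (pmfExp_const A B))
    ((tendsto_pmfExp h hB fun _ => hfB _).comp (tendsto_add_atTop_nat 1)) fun t =>
      pmfExp_le_pmfExp_queueLaw_succ A p init t i hf

lemma QueueConvergesTo.integral_sub_nonneg_of_le (h : QueueConvergesTo A p init π) (i : Fin n)
    {f : ℕ → ℝ} (hf : Monotone f) (h0 : ∀ k, 0 ≤ f k) {B : ℝ} (hB : ∀ k, f k ≤ B) :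
    0 ≤ ∫ q, ∫ a, (f (rowSum i q) - f (rowSum i q + rowSum i a - 1)) ∂A.toMeasure
      ∂π.toMeasure := by
  have habs (k : ℕ) : |f k| ≤ B := (abs_of_nonneg (h0 k)).trans_le (hB k)
  have hintA (q : SwitchMat n) :
      Integrable (fun a => f (rowSum i q + rowSum i a - 1)) A.toMeasure :=
    integrable_toMeasure_of_abs_le A B fun _ _ => habs _
  have hint : Integrable (fun q => f (rowSum i q)) π.toMeasure :=
    integrable_toMeasure_of_abs_le π B fun _ _ => habs _
  have hintπ : Integrable
      (fun q => ∫ a, f (rowSum i q + rowSum i a - 1) ∂A.toMeasure) π.toMeasure :=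
    integrable_toMeasure_of_abs_le π B fun _ _ => abs_integral_toMeasure_le A fun _ _ => habs _
  have hle := h.pmfExp_le i (f := fun k => ENNReal.ofReal (f k))
    (fun _ _ hkl => ENNReal.ofReal_le_ofReal (hf hkl)) ENNReal.ofReal_ne_top
    fun k => ENNReal.ofReal_le_ofReal (hB k)
  simp only [pmfExp_ofReal A (hintA _) fun _ => h0 _] at hle
  rw [pmfExp_ofReal π hintπ fun _ => integral_nonneg fun _ => h0 _,
    pmfExp_ofReal π hint fun _ => h0 _,
    ENNReal.ofReal_le_ofReal_iff (integral_nonneg fun _ => h0 _)] at hle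
  simpa only [integral_sub (integrable_const _) (hintA _), integral_const, probReal_univ, one_smul,
    integral_sub hint hintπ, sub_nonneg] using hle

/-- The bounded case is applied to the truncations `f (min · K)`. -/
lemma QueueConvergesTo.integral_sub_nonneg (h : QueueConvergesTo A p init π) (i : Fin n)
    {f : ℕ → ℝ} (hf : Monotone f) (h0 : ∀ k, 0 ≤ f k) {C : SwitchMat n → ℝ}
    (hC : Integrable C π.toMeasure)
    (hfC : ∀ K q, ∀ a ∈ A.support,
      |f (min (rowSum i q) K) - f (min (rowSum i q + rowSum i a - 1) K)| ≤ C q) :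
    0 ≤ ∫ q, ∫ a, (f (rowSum i q) - f (rowSum i q + rowSum i a - 1)) ∂A.toMeasure
      ∂π.toMeasure := by
  have hlim (k : ℕ) : Tendsto (fun K => f (min k K)) atTop (𝓝 (f k)) :=
    tendsto_const_nhds.congr' <| (eventually_ge_atTop k).mono fun K hK => by
      simp only [min_eq_left hK]
  refine ge_of_tendsto' (tendsto_integral_of_dominated_convergence C
    (fun K => (measurable_of_countable _).aestronglyMeasurable) hC
    (fun K => .of_forall fun q => abs_integral_toMeasure_le A fun a ha => hfC K q a ha)
    (.of_forall fun q => tendsto_integral_of_dominated_convergence (fun _ => C q)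
      (fun K => (measurable_of_countable _).aestronglyMeasurable) (integrable_const _)
      (fun K => (ae_toMeasure_iff A).2 fun a ha => hfC K q a ha)
      (.of_forall fun a => (hlim _).sub (hlim _)))) fun K => ?_
  exact h.integral_sub_nonneg_of_le i (f := fun k => f (min k K))
    (fun k l hkl => hf (min_le_min_right K hkl)) (fun _ => h0 _) fun k => hf (min_le_right k K)

variable {amax : ℕ} {lam : Fin n → Fin n → ℝ} {i : Fin n} {ε : ℝ}

/-- With `m = r + a`, the new content `m - 1` of a single-server queue satisfies
`(m - 1) * (m - 1 + 1) = m * (m - 1)` also at `m = 0`, where natural subtraction truncates: the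
test function `k * (k + 1)` does not see the idle slots. -/
lemma cast_mul_succ_sub (r a : ℕ) :
    (r : ℝ) * (r + 1) - ((r + a - 1 : ℕ) : ℝ) * ((r + a - 1 : ℕ) + 1) =
      2 * r * (1 - a) - a * (a - 1) := by
  have hsub : ((r + a - 1 : ℕ) : ℝ) * ((r + a - 1 : ℕ) + 1) = (r + a) * (r + a - 1) := by
    rcases Nat.eq_zero_or_pos (r + a) with h | h
    · have hcast : (r : ℝ) + a = 0 := by exact_mod_cast h
      rw [h, hcast]
      simp
    · rw [Nat.cast_sub h]
      push_cast
      ring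
  rw [hsub]
  ring

lemma IsArrivalLaw.integral_mul_succ_sub (hA : IsArrivalLaw A amax lam)
    (hε : ∑ j, lam i j = 1 - ε) (r : ℕ) :
    ∫ a, ((r : ℝ) * (r + 1) - ((r + rowSum i a - 1 : ℕ) : ℝ) * ((r + rowSum i a - 1 : ℕ) + 1))
      ∂A.toMeasure = 2 * ε * r - (∑ j, arrivalVar A i j + ε ^ 2 - ε) := by
  have hexpand (a : SwitchMat n) :
      2 * (r : ℝ) * (1 - rowSum i a) - rowSum i a * (rowSum i a - 1) =
        2 * r + ((1 - 2 * r) * rowSum i a - (rowSum i a : ℝ) ^ 2) := by ring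
  simp only [cast_mul_succ_sub, hexpand]
  rw [hA.integral_const_add, integral_sub (hA.integrable _) (hA.integrable _),
    integral_const_mul, hA.integral_rowSum, hA.integral_rowSum_sq, hε]
  ring

lemma abs_min_sub_min_le {r a D : ℕ} (ha : a ≤ D) (K : ℕ) :
    |((min r K : ℕ) : ℝ) - (min (r + a - 1) K : ℕ)| ≤ D + 1 := by
  have hle : min r K ≤ min (r + a - 1) K + (D + 1) := by lia
  have hge : min (r + a - 1) K ≤ min r K + (D + 1) := by lia
  rify at hle hge ⊢
  rw [abs_le]
  constructor <;> linarith

lemma abs_mul_succ_min_sub_le {r a D : ℕ} (ha : a ≤ D) (K : ℕ) :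
    |((min r K : ℕ) : ℝ) * ((min r K : ℕ) + 1) -
      (min (r + a - 1) K : ℕ) * ((min (r + a - 1) K : ℕ) + 1)| ≤ (D + 1) * (2 * r + D + 1) := by
  have hu : ((min r K : ℕ) : ℝ) ≤ r := by exact_mod_cast min_le_left r K
  have hv : ((min (r + a - 1) K : ℕ) : ℝ) ≤ r + D := by
    exact_mod_cast (min_le_left _ K).trans (by lia)
  have habs := abs_min_sub_min_le (r := r) ha K
  have hu0 : (0 : ℝ) ≤ (min r K : ℕ) := Nat.cast_nonneg _
  have hv0 : (0 : ℝ) ≤ (min (r + a - 1) K : ℕ) := Nat.cast_nonneg _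
  generalize ((min r K : ℕ) : ℝ) = u, ((min (r + a - 1) K : ℕ) : ℝ) = v at *
  calc |u * (u + 1) - v * (v + 1)| = |u - v| * (u + v + 1) := by
        rw [← abs_of_nonneg (show 0 ≤ u + v + 1 by linarith), ← abs_mul]
        ring_nf
    _ ≤ (D + 1) * (2 * r + D + 1) :=
        mul_le_mul habs (by linarith) (by linarith) (by positivity)

theorem IsArrivalLaw.le_mul_meanRowQueue (hA : IsArrivalLaw A amax lam) (hε0 : 0 < ε)
    (hε : ∑ j, lam i j = 1 - ε) (h : QueueConvergesTo A p init π) :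
    ENNReal.ofReal ((∑ j, arrivalVar A i j + ε ^ 2 - ε) / 2) ≤
      ENNReal.ofReal ε * meanRowQueue π i := by
  by_cases htop : meanRowQueue π i = ∞
  · simp [htop, ENNReal.mul_top, hε0]
  rw [meanRowQueue_eq_pmfExp] at htop ⊢
  have hint : Integrable (fun q => (rowSum i q : ℝ)) π.toMeasure :=
    integrable_of_pmfExp_ne_top π (fun _ => Nat.cast_nonneg _) htop
  have hdrift := h.integral_sub_nonneg i (f := fun k => (k : ℝ) * (k + 1))
    (fun k l hkl => by dsimp only; gcongr) (fun k => by positivity)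
    (C := fun q => (((n * amax : ℕ) : ℝ) + 1) * (2 * rowSum i q + (n * amax : ℕ) + 1))
    ((((hint.const_mul 2).add (integrable_const _)).add (integrable_const _)).const_mul _)
    fun K q a ha => abs_mul_succ_min_sub_le (hA.rowSum_le ha i) K
  simp only [hA.integral_mul_succ_sub hε] at hdrift
  rw [integral_sub (hint.const_mul _) (integrable_const _), integral_const_mul, integral_const,
    probReal_univ, one_smul] at hdrift
  rw [pmfExp_ofReal π hint fun _ => Nat.cast_nonneg _, ← ENNReal.ofReal_mul hε0.le]
  exact ENNReal.ofReal_le_ofReal (by linarith)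

end AnyPolicy

section Geometry

variable {n : ℕ}

/-- The Euclidean inner product of matrices. -/
def matInner (x y : Fin n → Fin n → ℝ) : ℝ := ∑ i, ∑ j, x i j * y i j

/-- The orthogonal projection of a matrix to the matrices whose row `z` has sum zero. Its kernel,
the line spanned by the indicator matrix of row `z`, is what the queue lengths collapse to. -/
noncomputable def matPerp (z : Fin n) (x : Fin n → Fin n → ℝ) : Fin n → Fin n → ℝ :=
  fun i j => x i j - if i = z then (∑ k, x z k) / n else 0

lemma matInner_comm (x y : Fin n → Fin n → ℝ) : matInner x y = matInner y x := by
  simp only [matInner, mul_comm]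

lemma matInner_add_right (x y y' : Fin n → Fin n → ℝ) :
    matInner x (y + y') = matInner x y + matInner x y' := by
  simp only [matInner, Pi.add_apply, mul_add, Finset.sum_add_distrib]

lemma matInner_smul_right (c : ℝ) (x y : Fin n → Fin n → ℝ) :
    matInner x (c • y) = c * matInner x y := by
  simp only [matInner, Pi.smul_apply, smul_eq_mul, Finset.mul_sum, mul_left_comm]

lemma matInner_sub_right (x y y' : Fin n → Fin n → ℝ) :
    matInner x (y - y') = matInner x y - matInner x y' := by
  simp only [matInner, Pi.sub_apply, mul_sub, Finset.sum_sub_distrib]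

lemma matInner_add_self (x y : Fin n → Fin n → ℝ) :
    matInner (x + y) (x + y) = matInner x x + 2 * matInner x y + matInner y y := by
  rw [matInner_add_right, matInner_comm _ x, matInner_comm _ y, matInner_add_right,
    matInner_add_right, matInner_comm y x]
  ring

lemma matInner_self_nonneg (x : Fin n → Fin n → ℝ) : 0 ≤ matInner x x :=
  Finset.sum_nonneg fun _ _ => Finset.sum_nonneg fun _ _ => mul_self_nonneg _

lemma abs_le_sqrt_matInner_self (x : Fin n → Fin n → ℝ) (i j : Fin n) :
    |x i j| ≤ √(matInner x x) := by
  refine Real.abs_le_sqrt (sq (x i j) ▸ ?_)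
  calc x i j * x i j ≤ ∑ k, x i k * x i k :=
        Finset.single_le_sum (f := fun k => x i k * x i k) (fun _ _ => mul_self_nonneg _)
          (Finset.mem_univ j)
    _ ≤ matInner x x :=
        Finset.single_le_sum (f := fun i => ∑ k, x i k * x i k)
          (fun _ _ => Finset.sum_nonneg fun _ _ => mul_self_nonneg _) (Finset.mem_univ i)

lemma abs_matInner_le {x y : Fin n → Fin n → ℝ} {B C : ℝ} (hx : ∀ i j, |x i j| ≤ B)
    (hy : ∀ i j, |y i j| ≤ C) : |matInner x y| ≤ n ^ 2 * (B * C) := by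
  have hterm (i j : Fin n) : |x i j * y i j| ≤ B * C := by
    rw [abs_mul]
    exact mul_le_mul (hx i j) (hy i j) (abs_nonneg _) ((abs_nonneg _).trans (hx i j))
  calc |matInner x y| ≤ ∑ i, ∑ j, |x i j * y i j| :=
        (Finset.abs_sum_le_sum_abs _ _).trans
          (Finset.sum_le_sum fun i _ => Finset.abs_sum_le_sum_abs _ _)
    _ ≤ ∑ _i : Fin n, ∑ _j : Fin n, B * C :=
        Finset.sum_le_sum fun i _ => Finset.sum_le_sum fun j _ => hterm i j
    _ = n ^ 2 * (B * C) := by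
        simp only [Finset.sum_const, Finset.card_univ, Fintype.card_fin, nsmul_eq_mul]
        ring

lemma matPerp_add (z : Fin n) (x y : Fin n → Fin n → ℝ) :
    matPerp z (x + y) = matPerp z x + matPerp z y := by
  ext i j
  simp only [matPerp, Pi.add_apply, Finset.sum_add_distrib]
  split_ifs <;> ring

lemma sum_matPerp (z : Fin n) (x : Fin n → Fin n → ℝ) : ∑ j, matPerp z x z j = 0 := by
  have hn : (n : ℝ) ≠ 0 := Nat.cast_ne_zero.2 z.pos.ne'
  simp only [matPerp, if_true, Finset.sum_sub_distrib, Finset.sum_const, Finset.card_univ,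
    Fintype.card_fin, nsmul_eq_mul, mul_div_cancel₀ _ hn, sub_self]

lemma matInner_matPerp_right (z : Fin n) (x y : Fin n → Fin n → ℝ) :
    matInner x (matPerp z y) = matInner x y - (∑ j, x z j) * ((∑ k, y z k) / n) := by
  simp only [matInner, matPerp, mul_sub, Finset.sum_sub_distrib, mul_ite, mul_zero,
    ← Finset.sum_mul, Finset.sum_ite_irrel, Finset.sum_const_zero, Finset.sum_ite_eq',
    Finset.mem_univ, if_true]

lemma matInner_matPerp_matPerp (z : Fin n) (x y : Fin n → Fin n → ℝ) :
    matInner (matPerp z x) (matPerp z y) = matInner (matPerp z x) y := by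
  rw [matInner_matPerp_right, sum_matPerp, zero_mul, sub_zero]

lemma matInner_matPerp_left_of_sum_eq_zero (z : Fin n) (x : Fin n → Fin n → ℝ)
    {y : Fin n → Fin n → ℝ} (hy : ∑ j, y z j = 0) :
    matInner (matPerp z x) y = matInner x y := by
  rw [matInner_comm, matInner_matPerp_right, hy, zero_mul, sub_zero, matInner_comm]

lemma matInner_matPerp_self_le (z : Fin n) (x : Fin n → Fin n → ℝ) :
    matInner (matPerp z x) (matPerp z x) ≤ matInner x x := by
  rw [matInner_matPerp_matPerp, matInner_comm, matInner_matPerp_right, ← mul_div_assoc]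
  exact sub_le_self _ (div_nonneg (mul_self_nonneg _) (Nat.cast_nonneg _))

/-- A matrix of natural numbers as a matrix of real numbers. -/
def castMat (x : SwitchMat n) : Fin n → Fin n → ℝ := fun i j => x i j

lemma matInner_castMat (x s : SwitchMat n) :
    matInner (castMat x) (castMat s) = scheduleWeight x s := by
  simp only [matInner, castMat, scheduleWeight, Nat.cast_sum, Nat.cast_mul]

/-- The schedules among which MaxWeight chooses when the queue lengths are `x`. -/
def IsMaxWeightSchedule (x s : SwitchMat n) : Prop :=
  IsMaximalSchedule s ∧ ∀ s', IsSchedule s' → scheduleWeight x s' ≤ scheduleWeight x s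

/-- The row deficits `1 - ∑ j, y i j` and the column deficits have the same total, so the
normalized product of the deficits is what has to be added to `y`. -/
lemma exists_doublyStochastic_ge {y : Fin n → Fin n → ℝ} (hy : y ∈ capacityRegion n) :
    ∃ M ∈ doublyStochastic ℝ (Fin n), ∀ i j, y i j ≤ M i j := by
  obtain ⟨h0, hr, hc⟩ := hy
  let ρ (i : Fin n) : ℝ := 1 - ∑ j, y i j
  let κ (j : Fin n) : ℝ := 1 - ∑ i, y i j
  have hρ0 (i : Fin n) : 0 ≤ ρ i := sub_nonneg.2 (hr i)
  have hκ0 (j : Fin n) : 0 ≤ κ j := sub_nonneg.2 (hc j)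
  have hsum : ∑ j, κ j = ∑ i, ρ i := by
    simp only [ρ, κ, Finset.sum_sub_distrib]
    rw [Finset.sum_comm]
  have hcancel {c : ℝ} (hc0 : 0 ≤ c) (hcρ : c ≤ ∑ i, ρ i) : c * (∑ i, ρ i) / ∑ i, ρ i = c :=
    mul_div_cancel_of_imp fun h => le_antisymm (hcρ.trans_eq h) hc0
  have hadd (i j : Fin n) : y i j ≤ y i j + ρ i * κ j / ∑ i, ρ i :=
    le_add_of_nonneg_right <|
      div_nonneg (mul_nonneg (hρ0 i) (hκ0 j)) (Finset.sum_nonneg fun i _ => hρ0 i)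
  refine ⟨Matrix.of fun i j => y i j + ρ i * κ j / ∑ i, ρ i, ?_, hadd⟩
  rw [mem_doublyStochastic_iff_sum]
  simp only [Matrix.of_apply]
  refine ⟨fun i j => (h0 i j).trans (hadd i j), fun i => ?_, fun j => ?_⟩
  · rw [Finset.sum_add_distrib, ← Finset.sum_div, ← Finset.mul_sum, hsum,
      hcancel (hρ0 i) (Finset.single_le_sum (fun i _ => hρ0 i) (Finset.mem_univ i))]
    exact add_sub_cancel _ _
  · rw [Finset.sum_add_distrib, ← Finset.sum_div, ← Finset.sum_mul, mul_comm,
      hcancel (hκ0 j) (hsum ▸ Finset.single_le_sum (fun j _ => hκ0 j) (Finset.mem_univ j))]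
    exact add_sub_cancel _ _

lemma exists_isSchedule_castMat_eq_permMatrix (σ : Equiv.Perm (Fin n)) :
    ∃ s : SwitchMat n, IsSchedule s ∧ castMat s = σ.permMatrix ℝ := by
  refine ⟨fun i j => if σ i = j then 1 else 0, ⟨fun i => by simp, fun j => ?_⟩, ?_⟩
  · simp [← Equiv.eq_symm_apply]
  · ext i j
    simp [castMat, Equiv.Perm.permMatrix, PEquiv.toMatrix_apply, Equiv.toPEquiv_apply, eq_comm]

/-- By Birkhoff's theorem, MaxWeight maximizes the weight over the whole capacity region. -/
lemma IsMaxWeightSchedule.matInner_le {x s : SwitchMat n} (hs : IsMaxWeightSchedule x s)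
    {y : Fin n → Fin n → ℝ} (hy : y ∈ capacityRegion n) :
    matInner (castMat x) y ≤ matInner (castMat x) (castMat s) := by
  obtain ⟨M, hM, hyM⟩ := exists_doublyStochastic_ge hy
  have hlin : IsLinearMap ℝ fun M : Matrix (Fin n) (Fin n) ℝ => matInner (castMat x) M :=
    ⟨matInner_add_right _, fun c M => matInner_smul_right c _ M⟩
  have hperm : {M : Matrix (Fin n) (Fin n) ℝ | ∃ σ : Equiv.Perm (Fin n), σ.permMatrix ℝ = M} ⊆
      {M | matInner (castMat x) M ≤ matInner (castMat x) (castMat s)} := by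
    rintro _ ⟨σ, rfl⟩
    obtain ⟨s', hs', hcast⟩ := exists_isSchedule_castMat_eq_permMatrix σ
    rw [Set.mem_ofPred_eq, ← hcast, matInner_castMat, matInner_castMat]
    exact_mod_cast hs.2 s' hs'
  calc matInner (castMat x) y ≤ matInner (castMat x) M :=
        Finset.sum_le_sum fun i _ => Finset.sum_le_sum fun j _ =>
          mul_le_mul_of_nonneg_left (hyM i j) (Nat.cast_nonneg _)
    _ ≤ matInner (castMat x) (castMat s) :=
        convexHull_min hperm (convex_halfSpace_le hlin _)
          (doublyStochastic_eq_convexHull_permMatrix (R := ℝ) (n := Fin n) ▸ hM)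

lemma exists_neg_lineMap_mem_of_mem_intrinsicInterior {E : Type*} [NormedAddCommGroup E]
    [NormedSpace ℝ E] {s : Set E} {x c : E} (hx : x ∈ intrinsicInterior ℝ s) (hc : c ∈ s) :
    ∃ t < (0 : ℝ), AffineMap.lineMap x c t ∈ s := by
  obtain ⟨y, hy, rfl⟩ := mem_intrinsicInterior.1 hx
  let c' : affineSpan ℝ s := ⟨c, subset_affineSpan ℝ s hc⟩
  have : Nonempty (affineSpan ℝ s) := ⟨y⟩
  have htendsto : Tendsto (AffineMap.lineMap y c' : ℝ → affineSpan ℝ s) (𝓝 0) (𝓝 y) :=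
    AffineMap.lineMap_continuous.tendsto' 0 y (AffineMap.lineMap_apply_zero _ _)
  obtain ⟨t, ht, htneg⟩ := (((htendsto.eventually (isOpen_interior.mem_nhds hy)).filter_mono
    nhdsWithin_le_nhds).and (self_mem_nhdsWithin (s := Set.Iio (0 : ℝ)))).exists
  exact ⟨t, htneg, interior_subset (s := Subtype.val ⁻¹' s) ht⟩

lemma lt_of_mem_intrinsicInterior {E : Type*} [NormedAddCommGroup E] [NormedSpace ℝ E] {s : Set E}
    {x c : E} (hx : x ∈ intrinsicInterior ℝ s) (hc : c ∈ s) (φ : E →ₗ[ℝ] ℝ) {a : ℝ}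
    (hφ : ∀ y ∈ s, φ y ≤ a) (hφc : φ c < a) : φ x < a := by
  obtain ⟨t, ht, hmem⟩ := exists_neg_lineMap_mem_of_mem_intrinsicInterior hx hc
  have hle := hφ _ hmem
  rw [AffineMap.lineMap_apply_module, map_add, map_smul, map_smul, smul_eq_mul, smul_eq_mul] at hle
  nlinarith

lemma single_row_mem_saturatedFace {z : Fin n} (hz : z.val = 0) :
    (fun i _ => if i = z then 1 / (n : ℝ) else 0) ∈ saturatedFace n 1 0 := by
  have hn : (1 : ℝ) ≤ n := by exact_mod_cast z.pos
  have hn0 : (n : ℝ) ≠ 0 := (one_pos.trans_le hn).ne'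
  refine ⟨⟨fun i _ => ?_, fun i => ?_, fun j => ?_⟩, fun i hi => ?_, fun _ hj => by lia⟩
  · positivity
  · dsimp only
    split_ifs <;> simp [hn0]
  · simpa using inv_le_one_of_one_le₀ hn
  · have hiz : i = z := Fin.ext (by lia)
    simp [hiz, hn0]

lemma sum_row_lt_one_of_mem_intrinsicInterior {ν : Fin n → Fin n → ℝ}
    (hν : ν ∈ intrinsicInterior ℝ (saturatedFace n 1 0)) {z i : Fin n} (hz : z.val = 0)
    (hi : i ≠ z) : ∑ j, ν i j < 1 := by
  simpa [LinearMap.sum_apply] using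
    lt_of_mem_intrinsicInterior hν (single_row_mem_saturatedFace hz)
      (∑ j, (LinearMap.proj j : (Fin n → ℝ) →ₗ[ℝ] ℝ) ∘ₗ LinearMap.proj i)
      (fun y hy => by simpa [LinearMap.sum_apply] using hy.1.2.1 i)
      (by simp [LinearMap.sum_apply, hi])

lemma sum_col_lt_one_of_mem_intrinsicInterior (hn : 1 < n) {ν : Fin n → Fin n → ℝ}
    (hν : ν ∈ intrinsicInterior ℝ (saturatedFace n 1 0)) (j : Fin n) : ∑ i, ν i j < 1 := by
  have hinv : (n : ℝ)⁻¹ < 1 := inv_lt_one_of_one_lt₀ (by exact_mod_cast hn)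
  simpa [LinearMap.sum_apply] using
    lt_of_mem_intrinsicInterior hν
      (single_row_mem_saturatedFace (z := ⟨0, Nat.zero_lt_of_lt hn⟩) rfl)
      (∑ i, (LinearMap.proj j : (Fin n → ℝ) →ₗ[ℝ] ℝ) ∘ₗ LinearMap.proj i)
      (fun y hy => by simpa [LinearMap.sum_apply] using hy.1.2.2 j)
      (by simpa [LinearMap.sum_apply] using hinv)

/-- The rates `ν` stay in the capacity region under all perturbations of size at most `δ` that
preserve the sum of row `z`. -/
def HasMargin (z : Fin n) (δ : ℝ) (ν : Fin n → Fin n → ℝ) : Prop :=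
  ∀ d : Fin n → Fin n → ℝ, (∀ i j, |d i j| ≤ 1) → ∑ j, d z j = 0 → ν + δ • d ∈ capacityRegion n

lemma exists_hasMargin {z : Fin n} {ν : Fin n → Fin n → ℝ} (hpos : ∀ i j, 0 < ν i j)
    (hz : ∑ j, ν z j ≤ 1) (hrow : ∀ i, i ≠ z → ∑ j, ν i j < 1) (hcol : ∀ j, ∑ i, ν i j < 1) :
    ∃ δ : ℝ, 0 < δ ∧ HasMargin z δ ν := by
  have hsmall (c : ℝ) {η : ℝ} (hη : 0 < η) : ∀ᶠ δ in 𝓝[>] (0 : ℝ), δ * c < η :=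
    (((continuous_mul_const c).tendsto' 0 0 (zero_mul c)).eventually
      (gt_mem_nhds hη)).filter_mono nhdsWithin_le_nhds
  have hentry : ∀ᶠ δ in 𝓝[>] (0 : ℝ), ∀ i j, δ * 1 < ν i j :=
    eventually_all.2 fun i => eventually_all.2 fun j => hsmall 1 (hpos i j)
  have hrow' : ∀ᶠ δ in 𝓝[>] (0 : ℝ), ∀ i, i ≠ z → δ * n < 1 - ∑ j, ν i j :=
    eventually_all.2 fun i => eventually_imp_distrib_left.2 fun hi =>
      hsmall n (sub_pos.2 (hrow i hi))
  have hcol' : ∀ᶠ δ in 𝓝[>] (0 : ℝ), ∀ j, δ * n < 1 - ∑ i, ν i j :=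
    eventually_all.2 fun j => hsmall n (sub_pos.2 (hcol j))
  obtain ⟨δ, hδentry, hδrow, hδcol, hδ⟩ :=
    (hentry.and (hrow'.and (hcol'.and self_mem_nhdsWithin))).exists
  have hδ0 : 0 < δ := hδ
  have hsum_le {e : Fin n → ℝ} (he : ∀ k, |e k| ≤ 1) : δ * ∑ k, e k ≤ δ * n :=
    mul_le_mul_of_nonneg_left
      ((Finset.sum_le_sum fun k _ => (abs_le.1 (he k)).2).trans_eq (by simp)) hδ0.le
  refine ⟨δ, hδ0, fun d hd hdz => ⟨fun i j => ?_, fun i => ?_, fun j => ?_⟩⟩ <;>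
    simp only [Pi.add_apply, Pi.smul_apply, smul_eq_mul, Finset.sum_add_distrib, ← Finset.mul_sum]
  · nlinarith [(abs_le.1 (hd i j)).1, hδentry i j]
  · rcases eq_or_ne i z with rfl | hi
    · rwa [hdz, mul_zero, add_zero]
    · linarith [hsum_le fun j => hd i j, hδrow i hi]
  · linarith [hsum_le fun i => hd i j, hδcol j]

end Geometry

/-- The unused service: what the schedule `s` offers beyond the packets present. -/
def unusedService {n : ℕ} (x a s : SwitchMat n) : SwitchMat n :=
  fun i j => s i j - (x i j + a i j)

/-- The change of the queue lengths `x` in a slot with arrivals `a` and schedule `s`. -/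
def queueChange {n : ℕ} (x a s : SwitchMat n) : Fin n → Fin n → ℝ :=
  castMat (nextQueue x a s) - castMat x

/-- The squared distance of the queue lengths from the line of state space collapse. -/
noncomputable def perpSq {n : ℕ} (z : Fin n) (x : SwitchMat n) : ℝ :=
  matInner (matPerp z (castMat x)) (matPerp z (castMat x))

/-- A bound on the squared Euclidean norm of the change of the queue lengths in a slot. -/
def stepBound (n amax : ℕ) : ℝ := n ^ 2 * (amax + 1) ^ 2

section Slot

variable {n : ℕ} {amax : ℕ} {x a s : SwitchMat n} {z : Fin n}

lemma castMat_nextQueue (x a s : SwitchMat n) :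
    castMat (nextQueue x a s) = castMat x + queueChange x a s :=
  (add_sub_cancel _ _).symm

lemma queueChange_eq (x a s : SwitchMat n) :
    queueChange x a s = castMat a - castMat s + castMat (unusedService x a s) := by
  ext i j
  have hbalance : nextQueue x a s i j + s i j = x i j + a i j + unusedService x a s i j := by
    simp only [nextQueue, unusedService]
    lia
  rify at hbalance
  simp only [queueChange, castMat, Pi.sub_apply, Pi.add_apply]
  linarith

lemma IsSchedule.le_one (hs : IsSchedule s) (i j : Fin n) : s i j ≤ 1 :=
  (Finset.single_le_sum (fun _ _ => Nat.zero_le _) (Finset.mem_univ j)).trans (hs.1 i)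

lemma IsMaximalSchedule.isSchedule (hs : IsMaximalSchedule s) : IsSchedule s :=
  ⟨fun i => (hs.1 i).le, fun j => (hs.2 j).le⟩

lemma IsSchedule.castMat_mul_unusedService (hs : IsSchedule s) (x a : SwitchMat n) (i j : Fin n) :
    castMat x i j * castMat (unusedService x a s) i j = 0 := by
  have := hs.le_one i j
  simp only [castMat, mul_eq_zero, Nat.cast_eq_zero, unusedService]
  lia

lemma castMat_nextQueue_mul_unusedService (x a s : SwitchMat n) (i j : Fin n) :
    castMat (nextQueue x a s) i j * castMat (unusedService x a s) i j = 0 := by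
  simp only [castMat, mul_eq_zero, Nat.cast_eq_zero, nextQueue, unusedService]
  lia

lemma IsSchedule.abs_queueChange_le (hs : IsSchedule s) (ha : ∀ i j, a i j ≤ amax)
    (x : SwitchMat n) (i j : Fin n) : |queueChange x a s i j| ≤ amax + 1 := by
  have hub : nextQueue x a s i j ≤ x i j + (amax + 1) := by
    have := ha i j
    simp only [nextQueue]
    lia
  have hlb : x i j ≤ nextQueue x a s i j + 1 := by
    have := hs.le_one i j
    simp only [nextQueue]
    lia
  rify at hub hlb
  simp only [queueChange, castMat, Pi.sub_apply]
  rw [abs_le]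
  constructor <;> linarith

lemma stepBound_nonneg (n amax : ℕ) : 0 ≤ stepBound n amax := by
  unfold stepBound
  positivity

lemma IsSchedule.matInner_queueChange_self_le (hs : IsSchedule s) (ha : ∀ i j, a i j ≤ amax)
    (x : SwitchMat n) : matInner (queueChange x a s) (queueChange x a s) ≤ stepBound n amax := by
  have hΔ := hs.abs_queueChange_le ha x
  rw [stepBound, sq ((amax : ℝ) + 1)]
  exact (le_abs_self _).trans (abs_matInner_le hΔ hΔ)

lemma IsSchedule.matInner_queueChange (hs : IsSchedule s) (x a : SwitchMat n) :
    matInner (castMat x) (queueChange x a s) = matInner (castMat x) (castMat a - castMat s) := by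
  have hunused : matInner (castMat x) (castMat (unusedService x a s)) = 0 :=
    Finset.sum_eq_zero fun i _ => Finset.sum_eq_zero fun j _ =>
      hs.castMat_mul_unusedService x a i j
  rw [queueChange_eq, matInner_add_right, hunused, add_zero]

lemma IsSchedule.matInner_nextQueue_self_le (hs : IsSchedule s) (ha : ∀ i j, a i j ≤ amax)
    (x : SwitchMat n) :
    matInner (castMat (nextQueue x a s)) (castMat (nextQueue x a s)) ≤
      matInner (castMat x) (castMat x) + 2 * matInner (castMat x) (castMat a - castMat s) +
        stepBound n amax := by
  rw [castMat_nextQueue, matInner_add_self, hs.matInner_queueChange]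
  exact add_le_add_right (hs.matInner_queueChange_self_le ha x) _

lemma perpSq_nonneg (z : Fin n) (x : SwitchMat n) : 0 ≤ perpSq z x := matInner_self_nonneg _

lemma abs_matPerp_le_sqrt_perpSq (z : Fin n) (x : SwitchMat n) (i j : Fin n) :
    |matPerp z (castMat x) i j| ≤ √(perpSq z x) :=
  abs_le_sqrt_matInner_self _ i j

lemma perpSq_nextQueue (z : Fin n) (x a s : SwitchMat n) :
    perpSq z (nextQueue x a s) =
      perpSq z x + 2 * matInner (matPerp z (castMat x)) (queueChange x a s) +
        matInner (matPerp z (queueChange x a s)) (matPerp z (queueChange x a s)) := by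
  rw [perpSq, castMat_nextQueue, matPerp_add, matInner_add_self, matInner_matPerp_matPerp z
    (castMat x) (queueChange x a s), ← perpSq]

/-- Unused service occurs at empty queues only, where the projection cannot be positive. -/
lemma IsSchedule.matInner_matPerp_unusedService_nonpos (hs : IsSchedule s) (z : Fin n)
    (x a : SwitchMat n) :
    matInner (matPerp z (castMat x)) (castMat (unusedService x a s)) ≤ 0 := by
  refine Finset.sum_nonpos fun i _ => Finset.sum_nonpos fun j _ => ?_
  have hmean : 0 ≤ if i = z then (∑ k, castMat x z k) / n else 0 := by
    split_ifs
    · exact div_nonneg (Finset.sum_nonneg fun k _ => Nat.cast_nonneg _) (Nat.cast_nonneg _)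
    · exact le_rfl
  rw [matPerp, sub_mul, hs.castMat_mul_unusedService, zero_sub, neg_nonpos]
  exact mul_nonneg hmean (Nat.cast_nonneg _)

lemma IsSchedule.perpSq_nextQueue_le (hs : IsSchedule s) (ha : ∀ i j, a i j ≤ amax) (z : Fin n)
    (x : SwitchMat n) :
    perpSq z (nextQueue x a s) ≤ perpSq z x +
      2 * matInner (matPerp z (castMat x)) (castMat a - castMat s) + stepBound n amax := by
  have hunused := hs.matInner_matPerp_unusedService_nonpos z x a
  have hΔ := (matInner_matPerp_self_le z _).trans (hs.matInner_queueChange_self_le ha x)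
  have hsplit := matInner_add_right (matPerp z (castMat x)) (castMat a - castMat s)
    (castMat (unusedService x a s))
  rw [← queueChange_eq] at hsplit
  linarith [perpSq_nextQueue z x a s]

lemma IsSchedule.abs_perpSq_nextQueue_sub_le (hs : IsSchedule s) (ha : ∀ i j, a i j ≤ amax)
    (z : Fin n) (x : SwitchMat n) :
    |perpSq z (nextQueue x a s) - perpSq z x| ≤
      2 * (n ^ 2 * (√(perpSq z x) * (amax + 1))) + stepBound n amax := by
  have hcross := abs_matInner_le (abs_matPerp_le_sqrt_perpSq z x) (hs.abs_queueChange_le ha x)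
  have hΔ := (matInner_matPerp_self_le z _).trans (hs.matInner_queueChange_self_le ha x)
  have hΔ0 := matInner_self_nonneg (matPerp z (queueChange x a s))
  rw [abs_le] at hcross ⊢
  rw [perpSq_nextQueue]
  constructor <;> linarith

lemma IsSchedule.sq_perpSq_nextQueue_le (hs : IsSchedule s) (ha : ∀ i j, a i j ≤ amax)
    (z : Fin n) (x : SwitchMat n) :
    perpSq z (nextQueue x a s) ^ 2 ≤
      4 * perpSq z x * matInner (matPerp z (castMat x)) (castMat a - castMat s) +
        (perpSq z x ^ 2 + 2 * perpSq z x * stepBound n amax +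
          (8 * n ^ 2 * stepBound n amax * perpSq z x + 2 * stepBound n amax ^ 2)) := by
  have hle := mul_le_mul_of_nonneg_left (hs.perpSq_nextQueue_le ha z x) (perpSq_nonneg z x)
  have hdiff : (perpSq z (nextQueue x a s) - perpSq z x) ^ 2 ≤
      8 * n ^ 2 * stepBound n amax * perpSq z x + 2 * stepBound n amax ^ 2 :=
    calc (perpSq z (nextQueue x a s) - perpSq z x) ^ 2
        ≤ (2 * (n ^ 2 * (√(perpSq z x) * (amax + 1))) + stepBound n amax) ^ 2 :=
          sq_le_sq' (abs_le.1 (hs.abs_perpSq_nextQueue_sub_le ha z x)).1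
            (abs_le.1 (hs.abs_perpSq_nextQueue_sub_le ha z x)).2
      _ ≤ 2 * ((2 * (n ^ 2 * (√(perpSq z x) * (amax + 1)))) ^ 2 + stepBound n amax ^ 2) :=
          add_sq_le
      _ = 8 * n ^ 2 * stepBound n amax * perpSq z x + 2 * stepBound n amax ^ 2 := by
          have hsqrt := Real.sq_sqrt (perpSq_nonneg z x)
          simp only [mul_pow, hsqrt, stepBound]
          ring
  linarith

lemma cast_rowSum (z : Fin n) (x : SwitchMat n) : (rowSum z x : ℝ) = ∑ j, castMat x z j := by
  simp only [rowSum, Nat.cast_sum, castMat]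

lemma IsMaximalSchedule.rowSum_nextQueue (hs : IsMaximalSchedule s) (z : Fin n)
    (x a : SwitchMat n) :
    (rowSum z (nextQueue x a s) : ℝ) =
      rowSum z x + (rowSum z a - 1) + rowSum z (unusedService x a s) := by
  have hservice : (rowSum z s : ℝ) = 1 := mod_cast hs.1 z
  rw [← hservice]
  simp only [cast_rowSum, castMat_nextQueue, queueChange_eq, Pi.add_apply, Pi.sub_apply,
    Finset.sum_add_distrib, Finset.sum_sub_distrib, add_assoc]

/-- Where service of row `z` is unused the new queue is empty, so that its projection is minus the
mean of the row. -/
lemma rowSum_unusedService_mul_rowSum_nextQueue_le (z : Fin n) (x a s : SwitchMat n) :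
    (rowSum z (unusedService x a s) : ℝ) * rowSum z (nextQueue x a s) ≤
      n * (rowSum z (unusedService x a s) * √(perpSq z (nextQueue x a s))) := by
  have hn : (0 : ℝ) < n := Nat.cast_pos.2 z.pos
  have hterm (j : Fin n) : castMat (unusedService x a s) z j * (rowSum z (nextQueue x a s) / n) ≤
      castMat (unusedService x a s) z j * √(perpSq z (nextQueue x a s)) := by
    rcases mul_eq_zero.1 (castMat_nextQueue_mul_unusedService x a s z j) with h | h
    · have hproj := (abs_le.1 (abs_matPerp_le_sqrt_perpSq z (nextQueue x a s) z j)).1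
      rw [matPerp, if_pos rfl, h, ← cast_rowSum, zero_sub, neg_le_neg_iff] at hproj
      exact mul_le_mul_of_nonneg_left hproj (Nat.cast_nonneg _)
    · simp only [h, zero_mul, le_refl]
  have hsum := Finset.sum_le_sum fun j (_ : j ∈ Finset.univ) => hterm j
  rw [← Finset.sum_mul, ← Finset.sum_mul, ← cast_rowSum, ← mul_div_assoc, div_le_iff₀ hn] at hsum
  linarith

/-- The shift of the row content by `n * L` absorbs the first order effect of the unused service:
`U * V ≤ L * U + V ^ 2 / L` for the unused service `U ≤ 1` and the distance `V` to the line of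
collapse. -/
lemma IsMaximalSchedule.sq_rowSum_nextQueue_sub_le (hs : IsMaximalSchedule s) (z : Fin n)
    (x a : SwitchMat n) {L : ℝ} (hL : 0 < L) :
    (rowSum z (nextQueue x a s) - n * L) ^ 2 ≤
      (rowSum z x + (rowSum z a - 1) - n * L) ^ 2 +
        2 * n / L * perpSq z (nextQueue x a s) := by
  have hcollapse := rowSum_unusedService_mul_rowSum_nextQueue_le z x a s
  have hU0 : (0 : ℝ) ≤ rowSum z (unusedService x a s) := Nat.cast_nonneg _
  have hU1 : (rowSum z (unusedService x a s) : ℝ) ≤ 1 := by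
    exact_mod_cast (Finset.sum_le_sum fun j _ => tsub_le_self).trans (hs.1 z).le
  rw [eq_sub_of_add_eq (hs.rowSum_nextQueue z x a).symm, ← Real.sq_sqrt (perpSq_nonneg z _)]
  generalize (rowSum z (unusedService x a s) : ℝ) = U at *
  generalize √(perpSq z (nextQueue x a s)) = V at *
  generalize (rowSum z (nextQueue x a s) : ℝ) = r at *
  have hUV : U * V ≤ L * U + V ^ 2 / L := by
    rw [← sub_nonneg, show L * U + V ^ 2 / L - U * V =
      ((V - L * U / 2) ^ 2 + L ^ 2 * U * (1 - U / 4)) / L by field_simp; ring]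
    have : 0 ≤ 1 - U / 4 := by linarith
    positivity
  have hnUV : n * (U * V) ≤ n * (L * U + V ^ 2 / L) := by gcongr
  calc (r - n * L) ^ 2 = (r - U - n * L) ^ 2 + (2 * (U * r) - 2 * n * L * U - U ^ 2) := by ring
    _ ≤ (r - U - n * L) ^ 2 + 2 * (n * (V ^ 2 / L)) := by linarith [sq_nonneg U]
    _ = (r - U - n * L) ^ 2 + 2 * n / L * V ^ 2 := by ring

end Slot

section ExpectedDrift

variable {n : ℕ} {A : PMF (SwitchMat n)} {amax : ℕ} {lam ν : Fin n → Fin n → ℝ} {δ ε : ℝ}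
  {x s : SwitchMat n} {z : Fin n}

lemma IsArrivalLaw.integral_mono (hA : IsArrivalLaw A amax lam) {F G : SwitchMat n → ℝ}
    (h : ∀ a, (∀ i j, a i j ≤ amax) → F a ≤ G a) :
    ∫ a, F a ∂A.toMeasure ≤ ∫ a, G a ∂A.toMeasure :=
  integral_mono_ae (hA.integrable _) (hA.integrable _)
    ((ae_toMeasure_iff A).2 fun a ha => h a (hA.bounded a ha))

lemma IsArrivalLaw.integral_matInner (hA : IsArrivalLaw A amax lam) (y : Fin n → Fin n → ℝ) :
    ∫ a, matInner y (castMat a) ∂A.toMeasure = matInner y lam := by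
  simp only [matInner, castMat]
  rw [integral_finsetSum _ fun i _ => hA.integrable _]
  refine Finset.sum_congr rfl fun i _ => ?_
  rw [integral_finsetSum _ fun j _ => hA.integrable _]
  exact Finset.sum_congr rfl fun j _ => by rw [integral_const_mul, hA.mean]

lemma IsArrivalLaw.integral_mul_matInner_add (hA : IsArrivalLaw A amax lam)
    (y : Fin n → Fin n → ℝ) (s : SwitchMat n) (c d : ℝ) :
    ∫ a, (c * matInner y (castMat a - castMat s) + d) ∂A.toMeasure =
      c * matInner y (lam - castMat s) + d := by
  rw [integral_add (hA.integrable _) (integrable_const _), integral_const_mul]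
  simp only [matInner_sub_right]
  rw [integral_sub (hA.integrable _) (integrable_const _), hA.integral_matInner]
  simp

lemma IsArrivalLaw.integral_add_rowSum_sq (hA : IsArrivalLaw A amax lam) (i : Fin n) (c : ℝ) :
    ∫ a, (c + rowSum i a) ^ 2 ∂A.toMeasure = (c + ∑ j, lam i j) ^ 2 + ∑ j, arrivalVar A i j := by
  simp only [add_sq]
  rw [integral_add (hA.integrable _) (hA.integrable _), hA.integral_const_add,
    integral_const_mul, hA.integral_rowSum, hA.integral_rowSum_sq]
  ring

lemma IsMaxWeightSchedule.integral_matInner_nextQueue_self_le (hs : IsMaxWeightSchedule x s)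
    (hA : IsArrivalLaw A amax ((1 - ε) • ν)) (hν : ν ∈ capacityRegion n) :
    ∫ a, matInner (castMat (nextQueue x a s)) (castMat (nextQueue x a s)) ∂A.toMeasure ≤
      matInner (castMat x) (castMat x) - 2 * ε * matInner (castMat x) ν + stepBound n amax :=
  calc ∫ a, matInner (castMat (nextQueue x a s)) (castMat (nextQueue x a s)) ∂A.toMeasure
      ≤ ∫ a, (2 * matInner (castMat x) (castMat a - castMat s) +
          (matInner (castMat x) (castMat x) + stepBound n amax)) ∂A.toMeasure :=
        hA.integral_mono fun a ha => by linarith [hs.1.isSchedule.matInner_nextQueue_self_le ha x]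
    _ ≤ matInner (castMat x) (castMat x) - 2 * ε * matInner (castMat x) ν + stepBound n amax := by
        rw [hA.integral_mul_matInner_add, matInner_sub_right, matInner_smul_right]
        linarith [hs.matInner_le hν]

lemma IsMaxWeightSchedule.matInner_matPerp_sub_le (hs : IsMaxWeightSchedule x s)
    (hz : ∑ j, ν z j = 1) (hδ : HasMargin z δ ν) :
    matInner (matPerp z (castMat x)) (ν - castMat s) ≤ -δ * √(perpSq z x) := by
  have hsmall (i j : Fin n) : |((√(perpSq z x))⁻¹ • matPerp z (castMat x)) i j| ≤ 1 := by
    simp only [Pi.smul_apply, smul_eq_mul]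
    rw [abs_mul, abs_inv, abs_of_nonneg (Real.sqrt_nonneg _)]
    exact inv_mul_le_one_of_le₀ (abs_matPerp_le_sqrt_perpSq z x i j) (Real.sqrt_nonneg _)
  have hsum : ∑ j, ((√(perpSq z x))⁻¹ • matPerp z (castMat x)) z j = 0 := by
    simp only [Pi.smul_apply, smul_eq_mul, ← Finset.mul_sum, sum_matPerp, mul_zero]
  have hle := hs.matInner_le (hδ _ hsmall hsum)
  have hservice : ∑ j, (s z j : ℝ) = 1 := mod_cast hs.1.1 z
  rw [matInner_add_right, matInner_smul_right, matInner_smul_right,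
    matInner_comm _ (matPerp z _), ← matInner_matPerp_matPerp, ← perpSq, inv_mul_eq_div,
    Real.div_sqrt] at hle
  rw [matInner_matPerp_left_of_sum_eq_zero, matInner_sub_right]
  · linarith
  · simp only [Pi.sub_apply, castMat, Finset.sum_sub_distrib, hz, hservice, sub_self]

lemma neg_matInner_le_of_mem_capacityRegion (hν : ν ∈ capacityRegion n)
    {y : Fin n → Fin n → ℝ} {V : ℝ} (hV : 0 ≤ V) (hy : ∀ i j, |y i j| ≤ V) :
    -matInner y ν ≤ n * V :=
  calc -matInner y ν = ∑ i, ∑ j, -y i j * ν i j := by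
        simp only [matInner, neg_mul, Finset.sum_neg_distrib]
    _ ≤ ∑ i, ∑ j, V * ν i j :=
        Finset.sum_le_sum fun i _ => Finset.sum_le_sum fun j _ =>
          mul_le_mul_of_nonneg_right ((neg_le_abs _).trans (hy i j)) (hν.1 i j)
    _ ≤ ∑ _i : Fin n, V := Finset.sum_le_sum fun i _ => by
        rw [← Finset.mul_sum]
        exact mul_le_of_le_one_right hV (hν.2.1 i)
    _ = n * V := by simp

/-- For the arrival rates `lam`, the schedule `s` pushes the queue lengths `x` towards the line of
state space collapse at a rate of at least `δ / 2`. -/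
def HasPerpDrift (z : Fin n) (δ : ℝ) (lam : Fin n → Fin n → ℝ) (x s : SwitchMat n) : Prop :=
  2 * matInner (matPerp z (castMat x)) (lam - castMat s) ≤ -δ * √(perpSq z x)

lemma IsMaxWeightSchedule.hasPerpDrift (hs : IsMaxWeightSchedule x s) (hν : ν ∈ capacityRegion n)
    (hz : ∑ j, ν z j = 1) (hδ : HasMargin z δ ν) (hε0 : 0 ≤ ε) (hε : n * ε ≤ δ / 2) :
    HasPerpDrift z δ ((1 - ε) • ν) x s := by
  have hV0 := Real.sqrt_nonneg (perpSq z x)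
  have hsplit : (1 - ε) • ν - castMat s = (ν - castMat s) + (-ε) • ν := by module
  have hlin := mul_le_mul_of_nonneg_left
    (neg_matInner_le_of_mem_capacityRegion hν hV0 (abs_matPerp_le_sqrt_perpSq z x)) hε0
  rw [HasPerpDrift, hsplit, matInner_add_right, matInner_smul_right]
  linarith [hs.matInner_matPerp_sub_le hz hδ, mul_le_mul_of_nonneg_right hε hV0]

lemma HasPerpDrift.integral_perpSq_le (h : HasPerpDrift z δ lam x s) (hδ : 0 ≤ δ)
    (hs : IsSchedule s) (hA : IsArrivalLaw A amax lam) :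
    ∫ a, perpSq z (nextQueue x a s) ∂A.toMeasure ≤ perpSq z x + stepBound n amax :=
  calc ∫ a, perpSq z (nextQueue x a s) ∂A.toMeasure
      ≤ ∫ a, (2 * matInner (matPerp z (castMat x)) (castMat a - castMat s) +
          (perpSq z x + stepBound n amax)) ∂A.toMeasure :=
        hA.integral_mono fun a ha => by linarith [hs.perpSq_nextQueue_le ha z x]
    _ ≤ perpSq z x + stepBound n amax := by
        rw [hA.integral_mul_matInner_add]
        have := mul_nonneg hδ (Real.sqrt_nonneg (perpSq z x))
        rw [HasPerpDrift] at h
        linarith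

lemma mul_sq_sub_mul_cube_le {C V : ℝ} (hδ : 0 < δ) (hC : 0 ≤ C) (hV : 0 ≤ V) :
    C * V ^ 2 - 2 * δ * V ^ 3 ≤ C ^ 3 / (4 * δ ^ 2) := by
  rcases le_total C (2 * δ * V) with h | h
  · calc C * V ^ 2 - 2 * δ * V ^ 3 = (C - 2 * δ * V) * V ^ 2 := by ring
      _ ≤ 0 := mul_nonpos_of_nonpos_of_nonneg (sub_nonpos.2 h) (sq_nonneg V)
      _ ≤ C ^ 3 / (4 * δ ^ 2) := by positivity
  · calc C * V ^ 2 - 2 * δ * V ^ 3 ≤ C * V ^ 2 := sub_le_self _ (by positivity)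
      _ = C * (2 * δ * V) ^ 2 / (4 * δ ^ 2) := by field
      _ ≤ C * C ^ 2 / (4 * δ ^ 2) := by gcongr
      _ = C ^ 3 / (4 * δ ^ 2) := by ring

/-- A bound, uniform in the load, on the stationary mean of `perpSq`. Its shape comes from
`mul_sq_sub_mul_cube_le`. -/
noncomputable def collapseBound (n amax : ℕ) (δ : ℝ) : ℝ :=
  (2 * stepBound n amax + 8 * n ^ 2 * stepBound n amax + 1) ^ 3 / (4 * δ ^ 2) +
    2 * stepBound n amax ^ 2

lemma HasPerpDrift.integral_perpSq_sq_le (h : HasPerpDrift z δ lam x s) (hδ : 0 < δ)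
    (hs : IsSchedule s) (hA : IsArrivalLaw A amax lam) :
    ∫ a, perpSq z (nextQueue x a s) ^ 2 ∂A.toMeasure ≤
      perpSq z x ^ 2 - perpSq z x + collapseBound n amax δ := by
  have hK := stepBound_nonneg n amax
  have hcubic := mul_sq_sub_mul_cube_le hδ
    (by positivity : 0 ≤ 2 * stepBound n amax + 8 * n ^ 2 * stepBound n amax + 1)
    (Real.sqrt_nonneg (perpSq z x))
  rw [pow_succ _ 2, Real.sq_sqrt (perpSq_nonneg z x)] at hcubic
  calc ∫ a, perpSq z (nextQueue x a s) ^ 2 ∂A.toMeasure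
      ≤ 4 * perpSq z x * matInner (matPerp z (castMat x)) (lam - castMat s) +
          (perpSq z x ^ 2 + 2 * perpSq z x * stepBound n amax +
            (8 * n ^ 2 * stepBound n amax * perpSq z x + 2 * stepBound n amax ^ 2)) :=
        (hA.integral_mono fun a ha => hs.sq_perpSq_nextQueue_le ha z x).trans_eq
          (hA.integral_mul_matInner_add _ _ _ _)
    _ ≤ perpSq z x ^ 2 - perpSq z x + collapseBound n amax δ := by
        rw [collapseBound]
        linarith [mul_le_mul_of_nonneg_left h (perpSq_nonneg z x)]

/-- The Lyapunov function for the content of row `z`, with a parameter `L`. -/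
noncomputable def rowLyapunov (z : Fin n) (L : ℝ) (x : SwitchMat n) : ℝ :=
  (rowSum z x - n * L) ^ 2 + 2 * n / L * perpSq z x ^ 2

lemma HasPerpDrift.integral_rowLyapunov_le (h : HasPerpDrift z δ lam x s) (hδ : 0 < δ)
    (hs : IsMaximalSchedule s) (hA : IsArrivalLaw A amax lam) (hε : ∑ j, lam z j = 1 - ε)
    {L : ℝ} (hL : 0 < L) :
    ∫ a, rowLyapunov z L (nextQueue x a s) ∂A.toMeasure ≤
      rowLyapunov z L x - 2 * ε * rowSum z x +
        (∑ j, arrivalVar A z j + ε ^ 2 + 2 * n * L * ε +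
          2 * n / L * (stepBound n amax + collapseBound n amax δ)) := by
  have hc : 0 ≤ 2 * n / L := by positivity
  have hW := mul_le_mul_of_nonneg_left (h.integral_perpSq_le hδ.le hs.isSchedule hA) hc
  have hW2 := mul_le_mul_of_nonneg_left (h.integral_perpSq_sq_le hδ hs.isSchedule hA) hc
  calc ∫ a, rowLyapunov z L (nextQueue x a s) ∂A.toMeasure
      ≤ ∫ a, ((rowSum z x - 1 - n * L + rowSum z a) ^ 2 +
          (2 * n / L * perpSq z (nextQueue x a s) +
            2 * n / L * perpSq z (nextQueue x a s) ^ 2)) ∂A.toMeasure :=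
        hA.integral_mono fun a _ => by
          rw [rowLyapunov]
          linarith [hs.sq_rowSum_nextQueue_sub_le z x a hL]
    _ = (rowSum z x - 1 - n * L + (1 - ε)) ^ 2 + ∑ j, arrivalVar A z j +
          (2 * n / L * ∫ a, perpSq z (nextQueue x a s) ∂A.toMeasure +
            2 * n / L * ∫ a, perpSq z (nextQueue x a s) ^ 2 ∂A.toMeasure) := by
        rw [integral_add (hA.integrable _) (hA.integrable _),
          integral_add (hA.integrable _) (hA.integrable _), integral_const_mul,
          integral_const_mul, hA.integral_add_rowSum_sq, hε]
    _ ≤ _ := by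
        rw [rowLyapunov]
        linarith

end ExpectedDrift

section MaxWeightChain

variable {n : ℕ} {A π : PMF (SwitchMat n)} {amax : ℕ} {lam ν : Fin n → Fin n → ℝ} {δ ε : ℝ}
  {p : SchedulingPolicy n} {z : Fin n} {x : SwitchMat n}

/-- The transition probabilities of the queue lengths when the schedule has law `r x` for queue
lengths `x`. -/
noncomputable def queueKernel (A : PMF (SwitchMat n)) (r : SwitchMat n → PMF (SwitchMat n))
    (x : SwitchMat n) : PMF (SwitchMat n) :=
  (r x).bind fun s => A.map fun a => nextQueue x a s

lemma queueLaw_eq_markovLaw {r : SwitchMat n → PMF (SwitchMat n)}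
    (hp : ∀ h, p.choose h = r h.1) (init : PMF (SwitchMat n)) (t : ℕ) :
    queueLaw A p init t = markovLaw (queueKernel A r) init t := by
  induction t with
  | zero =>
    rw [queueLaw, historyLaw, PMF.map_comp, markovLaw]
    exact PMF.map_id init
  | succ t ih =>
    rw [markovLaw, ← ih, queueLaw, historyLaw, queueLaw, PMF.map_bind, PMF.bind_map]
    congr 1
    ext1 h
    rw [switchStep, PMF.map_bind, hp]
    simp only [PMF.map_comp]
    rfl

lemma IsArrivalLaw.hasDrift_queueKernel (hA : IsArrivalLaw A amax lam)
    {r : SwitchMat n → PMF (SwitchMat n)}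
    (hr : ∀ x, ∀ s ∈ (r x).support, IsMaxWeightSchedule x s) {f g : SwitchMat n → ℝ} {b : ℝ}
    (hf : ∀ x, 0 ≤ f x) (hg : ∀ x, 0 ≤ g x)
    (h : ∀ x s, IsMaxWeightSchedule x s →
      ∫ a, f (nextQueue x a s) ∂A.toMeasure ≤ f x - g x + b) :
    HasDrift (queueKernel A r) (fun x => ENNReal.ofReal (f x)) (fun x => ENNReal.ofReal (g x))
      (ENNReal.ofReal b) := by
  intro x
  calc pmfExp (queueKernel A r x) (fun y => ENNReal.ofReal (f y)) + ENNReal.ofReal (g x)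
      = pmfExp (r x) fun s => ENNReal.ofReal (∫ a, f (nextQueue x a s) ∂A.toMeasure) +
          ENNReal.ofReal (g x) := by
        simp only [queueKernel, pmfExp_bind, pmfExp_map, pmfExp_add, pmfExp_const,
          pmfExp_ofReal A (hA.integrable fun a => f (nextQueue x a _)) fun _ => hf _]
    _ ≤ pmfExp (r x) fun _ => ENNReal.ofReal (f x) + ENNReal.ofReal b :=
        pmfExp_mono fun s hs => by
          rw [← ENNReal.ofReal_add (integral_nonneg fun a => hf _) (hg x)]
          refine (ENNReal.ofReal_le_ofReal ?_).trans ENNReal.ofReal_add_le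
          linarith [h x s (hr x s hs)]
    _ = ENNReal.ofReal (f x) + ENNReal.ofReal b := pmfExp_const _ _

lemma IsArrivalLaw.exists_mem_support_eq_zero (hA : IsArrivalLaw A amax lam) {i j : Fin n}
    (hlam : lam i j < 1) : ∃ a ∈ A.support, a i j = 0 := by
  by_contra! hpos
  have hone : ∀ a ∈ A.support, (1 : ℝ) ≤ a i j := fun a ha =>
    mod_cast Nat.one_le_iff_ne_zero.2 (hpos a ha)
  have hmean := integral_mono_ae (integrable_const 1) (hA.integrable _)
    ((ae_toMeasure_iff A).2 hone)
  rw [hA.mean, integral_const, probReal_univ, one_smul] at hmean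
  exact hlam.not_ge hmean

lemma IsArrivalLaw.zero_mem_support (hA : IsArrivalLaw A amax lam) (hlam : ∀ i j, lam i j < 1) :
    0 ∈ A.support := by
  have hprod := hA.indep.measure_inter_preimage_eq_mul Finset.univ (sets := fun _ => {0})
    fun _ _ => MeasurableSet.singleton _
  have hzero : (⋂ ij ∈ (Finset.univ : Finset (Fin n × Fin n)),
      (fun a : SwitchMat n => a ij.1 ij.2) ⁻¹' {0}) = {0} := by
    ext a
    simp [funext_iff]
  rw [hzero, PMF.toMeasure_apply_singleton _ _ (MeasurableSet.singleton _)] at hprod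
  rw [PMF.mem_support_iff, hprod, Finset.prod_ne_zero_iff]
  rintro ⟨i, j⟩ - hnull
  obtain ⟨a, ha, haij⟩ := hA.exists_mem_support_eq_zero (hlam i j)
  exact Set.disjoint_left.1 ((A.toMeasure_apply_eq_zero_iff
    (Set.to_countable _).measurableSet).1 hnull) ha haij

lemma IsMaxWeightSchedule.exists_ne_zero {s : SwitchMat n} (hs : IsMaxWeightSchedule x s)
    (hx : x ≠ 0) : ∃ i j, x i j ≠ 0 ∧ s i j ≠ 0 := by
  by_contra! hzero
  obtain ⟨k, hk⟩ := Function.ne_iff.1 hx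
  obtain ⟨l, hkl⟩ := Function.ne_iff.1 hk
  have hsingle : IsSchedule fun i j : Fin n => if i = k ∧ j = l then 1 else 0 :=
    ⟨fun i => by by_cases hi : i = k <;> simp [hi], fun j => by by_cases hj : j = l <;> simp [hj]⟩
  have hs0 : scheduleWeight x s = 0 :=
    Finset.sum_eq_zero fun i _ => Finset.sum_eq_zero fun j _ =>
      mul_eq_zero.2 (or_iff_not_imp_left.2 (hzero i j))
  have hweight := (hs.2 _ hsingle).trans_eq hs0
  simp only [scheduleWeight, ite_and, mul_ite, mul_one, mul_zero, Finset.sum_ite_irrel,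
    Finset.sum_const_zero, Finset.sum_ite_eq', Finset.mem_univ, if_true] at hweight
  exact hkl (Nat.le_zero.1 hweight)

lemma IsMaxWeightSchedule.sum_nextQueue_zero_lt {s : SwitchMat n} (hs : IsMaxWeightSchedule x s)
    (hx : x ≠ 0) : ∑ i, ∑ j, nextQueue x 0 s i j < ∑ i, ∑ j, x i j := by
  obtain ⟨k, l, hxkl, hskl⟩ := hs.exists_ne_zero hx
  have hle (i j : Fin n) : nextQueue x 0 s i j ≤ x i j := tsub_le_self
  have hlt : nextQueue x 0 s k l < x k l := by
    simp only [nextQueue, Pi.zero_apply]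
    lia
  exact Finset.sum_lt_sum (fun i _ => Finset.sum_le_sum fun j _ => hle i j)
    ⟨k, Finset.mem_univ k, Finset.sum_lt_sum (fun j _ => hle k j) ⟨l, Finset.mem_univ l, hlt⟩⟩

lemma tendsto_matInner_castMat_cofinite (hν : ∀ i j, 0 < ν i j) :
    Tendsto (fun x : SwitchMat n => matInner (castMat x) ν) cofinite atTop := by
  refine tendsto_atTop.2 fun R => eventually_cofinite.2 <|
    (Set.Finite.pi' fun i => Set.Finite.pi' fun j => Set.finite_Iic ⌊R / ν i j⌋₊).subset
      fun x hx i j => Nat.le_floor ((le_div_iff₀ (hν i j)).2 ?_)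
  have hterm (i j : Fin n) : 0 ≤ castMat x i j * ν i j :=
    mul_nonneg (Nat.cast_nonneg _) (hν i j).le
  calc castMat x i j * ν i j ≤ ∑ j, castMat x i j * ν i j :=
        Finset.single_le_sum (fun j _ => hterm i j) (Finset.mem_univ j)
    _ ≤ matInner (castMat x) ν :=
        Finset.single_le_sum (f := fun i => ∑ j, castMat x i j * ν i j)
          (fun i _ => Finset.sum_nonneg fun j _ => hterm i j) (Finset.mem_univ i)
    _ ≤ R := (not_le.1 hx).le

lemma SchedulingPolicy.IsMaxWeight.exists_queueConvergesTo (hp : p.IsMaxWeight)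
    (hε : ε ∈ Set.Ioo 0 1) (hA : IsArrivalLaw A amax ((1 - ε) • ν)) (hν : ν ∈ capacityRegion n)
    (hν_pos : ∀ i j, 0 < ν i j) : ∃ π, ∀ init, QueueConvergesTo A p init π := by
  obtain ⟨r, hpr, hr⟩ := hp
  have hinner (x : SwitchMat n) : 0 ≤ matInner (castMat x) ν :=
    Finset.sum_nonneg fun i _ => Finset.sum_nonneg fun j _ =>
      mul_nonneg (Nat.cast_nonneg _) (hν.1 i j)
  have hε2 : 0 < 2 * ε := mul_pos two_pos hε.1
  have hdrift := hA.hasDrift_queueKernel hr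
    (fun x => matInner_self_nonneg (castMat x)) (fun x => mul_nonneg hε2.le (hinner x))
    fun x s hs => hs.integral_matInner_nextQueue_self_le hA hν
  have hcoercive := ENNReal.tendsto_ofReal_atTop.comp
    ((tendsto_matInner_castMat_cofinite hν_pos).const_mul_atTop hε2)
  have hlam (i j : Fin n) : ((1 - ε) • ν) i j < 1 := by
    have hνij : ν i j ≤ 1 :=
      (Finset.single_le_sum (fun j _ => hν.1 i j) (Finset.mem_univ j)).trans (hν.2.1 i)
    exact mul_lt_one_of_nonneg_of_lt_one_left (sub_nonneg.2 hε.2.le)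
      (sub_lt_self 1 hε.1) hνij
  have hidle {x s : SwitchMat n} (hs : s ∈ (r x).support) :
      nextQueue x 0 s ∈ (queueKernel A r x).support :=
    (PMF.mem_support_bind_iff _ _ _).2
      ⟨s, hs, (PMF.mem_support_map_iff _ _ _).2 ⟨0, hA.zero_mem_support hlam, rfl⟩⟩
  choose s hs using fun x => (r x).support_nonempty
  have hempty : 0 ∈ (queueKernel A r 0).support := by
    convert hidle (hs 0)
    ext i j
    simp [nextQueue]
  obtain ⟨π, hπ⟩ := hdrift.exists_tendsto (ℓ := fun x => ∑ i, ∑ j, x i j)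
    ENNReal.ofReal_ne_top hcoercive (fun x => ENNReal.ofReal_ne_top) hempty
    fun x hx => ⟨_, hidle (hs x), IsMaxWeightSchedule.sum_nextQueue_zero_lt (hr x _ (hs x)) hx⟩
  exact ⟨π, fun init q => by simpa only [queueLaw_eq_markovLaw hpr] using hπ init q⟩

lemma SchedulingPolicy.IsMaxWeight.pmfExp_le (hp : p.IsMaxWeight) (hA : IsArrivalLaw A amax lam)
    (hπ : QueueConvergesTo A p (PMF.pure x) π) {f g : SwitchMat n → ℝ} {b : ℝ}
    (hf : ∀ x, 0 ≤ f x) (hg : ∀ x, 0 ≤ g x)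
    (h : ∀ x s, IsMaxWeightSchedule x s →
      ∫ a, f (nextQueue x a s) ∂A.toMeasure ≤ f x - g x + b) :
    pmfExp π (fun x => ENNReal.ofReal (g x)) ≤ ENNReal.ofReal b := by
  obtain ⟨r, hpr, hr⟩ := hp
  refine (hA.hasDrift_queueKernel hr hf hg h).pmfExp_le (μ := PMF.pure x)
    (fun x => ENNReal.ofReal_ne_top) (by rw [pmfExp_pure]; exact ENNReal.ofReal_ne_top) fun q => ?_
  simpa only [queueLaw_eq_markovLaw hpr] using hπ q

lemma cast_le_perpSq {i : Fin n} (hi : i ≠ z) (x : SwitchMat n) (j : Fin n) :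
    (x i j : ℝ) ≤ perpSq z x := by
  have hperp := abs_matPerp_le_sqrt_perpSq z x i j
  rw [matPerp, if_neg hi, sub_zero, castMat, Nat.abs_cast,
    Real.le_sqrt (Nat.cast_nonneg _) (perpSq_nonneg z x)] at hperp
  exact le_trans (mod_cast Nat.le_self_pow two_ne_zero _) hperp

lemma SchedulingPolicy.IsMaxWeight.meanQueue_le (hp : p.IsMaxWeight)
    (hA : IsArrivalLaw A amax lam) (hδ : 0 < δ)
    (h : ∀ x s, IsMaxWeightSchedule x s → HasPerpDrift z δ lam x s)
    (hπ : QueueConvergesTo A p (PMF.pure x) π) {i : Fin n} (hi : i ≠ z) (j : Fin n) :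
    meanQueue π i j ≤ ENNReal.ofReal (collapseBound n amax δ) := by
  rw [meanQueue_eq_pmfExp]
  refine (pmfExp_mono fun x _ => ?_).trans <|
    hp.pmfExp_le hA hπ (fun x => sq_nonneg (perpSq z x)) (perpSq_nonneg z) fun x s hs =>
      (h x s hs).integral_perpSq_sq_le hδ hs.1.isSchedule hA
  rw [← ENNReal.ofReal_natCast]
  exact ENNReal.ofReal_le_ofReal (cast_le_perpSq hi x j)

lemma SchedulingPolicy.IsMaxWeight.mul_meanRowQueue_le (hp : p.IsMaxWeight)
    (hA : IsArrivalLaw A amax lam) (hε0 : 0 ≤ ε) (hε : ∑ j, lam z j = 1 - ε) (hδ : 0 < δ)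
    (h : ∀ x s, IsMaxWeightSchedule x s → HasPerpDrift z δ lam x s)
    (hπ : QueueConvergesTo A p (PMF.pure x) π) {L : ℝ} (hL : 0 < L) :
    ENNReal.ofReal ε * meanRowQueue π z ≤ ENNReal.ofReal ((∑ j, arrivalVar A z j + ε ^ 2 +
      2 * n * L * ε + 2 * n / L * (stepBound n amax + collapseBound n amax δ)) / 2) := by
  rw [meanRowQueue_eq_pmfExp, ← pmfExp_const_mul]
  simp only [← ENNReal.ofReal_mul hε0]
  refine hp.pmfExp_le hA hπ (f := fun x => rowLyapunov z L x / 2)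
    (fun x => by unfold rowLyapunov; positivity) (fun x => by positivity) fun x s hs => ?_
  rw [integral_div]
  linarith [(h x s hs).integral_rowLyapunov_le hδ hs.1 hA hε hL]

end MaxWeightChain

section HeavyTraffic

variable {n : ℕ} {A : ℝ → PMF (SwitchMat n)} {amax : ℕ} {ν : Fin n → Fin n → ℝ} {δ v : ℝ}
  {p : ℝ → SchedulingPolicy n} {π : ℝ → PMF (SwitchMat n)} {z : Fin n}

lemma tendsto_ofReal_add_div_two {α : Type*} {l : Filter α} {V c : α → ℝ}
    (hV : Tendsto V l (𝓝 v)) (hc : Tendsto c l (𝓝 0)) :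
    Tendsto (fun a => ENNReal.ofReal ((V a + c a) / 2)) l (𝓝 (ENNReal.ofReal (v / 2))) := by
  simpa only [add_zero] using ENNReal.tendsto_ofReal ((hV.add hc).div_const 2)

lemma ofReal_half_le_liminf_mul_meanRowQueue {init : ℝ → PMF (SwitchMat n)}
    (hA : ∀ᶠ ε in 𝓝[>] 0, IsArrivalLaw (A ε) amax ((1 - ε) • ν)) (hz : ∑ j, ν z j = 1)
    (hvar : Tendsto (fun ε => ∑ j, arrivalVar (A ε) z j) (𝓝[>] 0) (𝓝 v))
    (hπ : ∀ᶠ ε in 𝓝[>] 0, QueueConvergesTo (A ε) (p ε) (init ε) (π ε)) :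
    ENNReal.ofReal (v / 2) ≤
      liminf (fun ε => ENNReal.ofReal ε * meanRowQueue (π ε) z) (𝓝[>] 0) := by
  have herror : Tendsto (fun ε : ℝ => ε ^ 2 - ε) (𝓝[>] 0) (𝓝 0) :=
    tendsto_nhdsWithin_of_tendsto_nhds <| Continuous.tendsto' (by fun_prop) _ _ (by simp)
  rw [← (tendsto_ofReal_add_div_two hvar herror).liminf_eq]
  refine liminf_le_liminf ?_
  filter_upwards [hA, hπ, self_mem_nhdsWithin] with ε hAε hπε hε
  rw [← add_sub_assoc]
  refine hAε.le_mul_meanRowQueue hε ?_ hπε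
  simp only [Pi.smul_apply, smul_eq_mul, ← Finset.mul_sum, hz, mul_one]

lemma eventually_hasPerpDrift (hν : ν ∈ capacityRegion n) (hz : ∑ j, ν z j = 1) (hδ : 0 < δ)
    (hmargin : HasMargin z δ ν) :
    ∀ᶠ ε : ℝ in 𝓝[>] 0, ∀ x s, IsMaxWeightSchedule x s → HasPerpDrift z δ ((1 - ε) • ν) x s := by
  have hload : Tendsto (fun ε : ℝ => n * ε) (𝓝[>] 0) (𝓝 0) :=
    tendsto_nhdsWithin_of_tendsto_nhds <| Continuous.tendsto' (by fun_prop) _ _ (by simp)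
  filter_upwards [self_mem_nhdsWithin, hload.eventually_le_const (half_pos hδ)]
    with ε hε0 hε x s hs
  exact hs.hasPerpDrift hν hz hmargin (le_of_lt hε0) hε

lemma tendsto_mul_meanQueue_zero {lam : ℝ → Fin n → Fin n → ℝ} {x : ℝ → SwitchMat n}
    (hA : ∀ᶠ ε in 𝓝[>] 0, IsArrivalLaw (A ε) amax (lam ε)) (hδ : 0 < δ)
    (hdrift : ∀ᶠ ε : ℝ in 𝓝[>] 0, ∀ x s, IsMaxWeightSchedule x s → HasPerpDrift z δ (lam ε) x s)
    (hp : ∀ᶠ ε in 𝓝[>] 0, (p ε).IsMaxWeight)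
    (hπ : ∀ᶠ ε in 𝓝[>] 0, QueueConvergesTo (A ε) (p ε) (PMF.pure (x ε)) (π ε))
    {i : Fin n} (hi : i ≠ z) (j : Fin n) :
    Tendsto (fun ε => ENNReal.ofReal ε * meanQueue (π ε) i j) (𝓝[>] 0) (𝓝 0) := by
  have hbound : Tendsto (fun ε => ENNReal.ofReal ε * ENNReal.ofReal (collapseBound n amax δ))
      (𝓝[>] 0) (𝓝 0) := by
    have hε : Tendsto ENNReal.ofReal (𝓝[>] 0) (𝓝 0) :=
      tendsto_nhdsWithin_of_tendsto_nhds (ENNReal.continuous_ofReal.tendsto' _ _ (by simp))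
    simpa only [zero_mul] using ENNReal.Tendsto.mul_const hε (.inr ENNReal.ofReal_ne_top)
  refine tendsto_of_tendsto_of_tendsto_of_le_of_le' tendsto_const_nhds hbound
    (.of_forall fun _ => zero_le) ?_
  filter_upwards [hA, hdrift, hp, hπ] with ε hAε hdriftε hpε hπε
  exact mul_le_mul_right (hpε.meanQueue_le hAε hδ hdriftε hπε hi j) _

lemma tendsto_mul_meanRowQueue {x : ℝ → SwitchMat n}
    (hA : ∀ᶠ ε in 𝓝[>] 0, IsArrivalLaw (A ε) amax ((1 - ε) • ν)) (hz : ∑ j, ν z j = 1)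
    (hvar : Tendsto (fun ε => ∑ j, arrivalVar (A ε) z j) (𝓝[>] 0) (𝓝 v)) (hδ : 0 < δ)
    (hdrift : ∀ᶠ ε : ℝ in 𝓝[>] 0, ∀ x s, IsMaxWeightSchedule x s →
      HasPerpDrift z δ ((1 - ε) • ν) x s)
    (hp : ∀ᶠ ε in 𝓝[>] 0, (p ε).IsMaxWeight)
    (hπ : ∀ᶠ ε in 𝓝[>] 0, QueueConvergesTo (A ε) (p ε) (PMF.pure (x ε)) (π ε)) :
    Tendsto (fun ε => ENNReal.ofReal ε * meanRowQueue (π ε) z) (𝓝[>] 0)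
      (𝓝 (ENNReal.ofReal (v / 2))) := by
  have herror : Tendsto (fun ε => ε ^ 2 + 2 * n * √ε +
      2 * n * √ε * (stepBound n amax + collapseBound n amax δ)) (𝓝[>] 0) (𝓝 0) :=
    tendsto_nhdsWithin_of_tendsto_nhds <| Continuous.tendsto' (by fun_prop) _ _ (by simp)
  have hupper : limsup (fun ε => ENNReal.ofReal ε * meanRowQueue (π ε) z) (𝓝[>] 0) ≤
      ENNReal.ofReal (v / 2) := by
    rw [← (tendsto_ofReal_add_div_two hvar herror).limsup_eq]
    refine limsup_le_limsup ?_
    filter_upwards [hA, hdrift, hp, hπ, self_mem_nhdsWithin] with ε hAε hdriftε hpε hπε hε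
    have hrow : ∑ j, ((1 - ε) • ν) z j = 1 - ε := by
      simp only [Pi.smul_apply, smul_eq_mul, ← Finset.mul_sum, hz, mul_one]
    -- `L = 1 / √ε` balances the error terms `L ε` and `1 / L`.
    refine (hpε.mul_meanRowQueue_le hAε (le_of_lt hε) hrow hδ hdriftε hπε
      (inv_pos.2 (Real.sqrt_pos.2 hε))).trans_eq ?_
    rw [div_inv_eq_mul, mul_assoc _ _ ε, inv_mul_eq_div, Real.div_sqrt, add_assoc, add_assoc,
      ← add_assoc (ε ^ 2)]
  exact tendsto_of_le_liminf_of_limsup_le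
    (ofReal_half_le_liminf_mul_meanRowQueue hA hz hvar hπ) hupper

end HeavyTraffic

theorem mainTheorem8 (n : ℕ) (hn : 1 < n)
    (ν : Fin n → Fin n → ℝ) (hν : ν ∈ intrinsicInterior ℝ (saturatedFace n 1 0))
    (hν_pos : ∀ i j, 0 < ν i j)
    (amax : ℕ) (A : ℝ → PMF (SwitchMat n))
    (hA : ∀ ε ∈ Set.Ioo (0 : ℝ) 1, IsArrivalLaw (A ε) amax fun i j => (1 - ε) * ν i j)
    (σ : Fin n → Fin n → ℝ)
    (hσ : ∀ i j, Tendsto (fun ε => arrivalVar (A ε) i j) (𝓝[>] 0) (𝓝 (σ i j ^ 2)))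
    (mw : ℝ → SchedulingPolicy n) (hmw : ∀ ε ∈ Set.Ioo (0 : ℝ) 1, (mw ε).IsMaxWeight) :
    ∃ π : ℝ → PMF (SwitchMat n),
      (∀ ε ∈ Set.Ioo (0 : ℝ) 1, ∀ init : PMF (SwitchMat n),
        QueueConvergesTo (A ε) (mw ε) init (π ε)) ∧
      Tendsto (fun ε => ENNReal.ofReal ε * meanRowQueue (π ε) ⟨0, Nat.zero_lt_of_lt hn⟩) (𝓝[>] 0)
        (𝓝 (ENNReal.ofReal ((∑ j, σ ⟨0, Nat.zero_lt_of_lt hn⟩ j ^ 2) / 2))) ∧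
      (∀ i : Fin n, 0 < i.val → ∀ j : Fin n,
        Tendsto (fun ε => ENNReal.ofReal ε * meanQueue (π ε) i j) (𝓝[>] 0) (𝓝 0)) ∧
      (∀ (p : ℝ → SchedulingPolicy n) (init π' : ℝ → PMF (SwitchMat n)),
        (∀ ε ∈ Set.Ioo (0 : ℝ) 1, QueueConvergesTo (A ε) (p ε) (init ε) (π' ε)) →
        ENNReal.ofReal ((∑ j, σ ⟨0, Nat.zero_lt_of_lt hn⟩ j ^ 2) / 2) ≤
          liminf (fun ε => ENNReal.ofReal ε * meanRowQueue (π' ε) ⟨0, Nat.zero_lt_of_lt hn⟩)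
            (𝓝[>] 0)) := by
  set z : Fin n := ⟨0, Nat.zero_lt_of_lt hn⟩
  have ⟨hcap, hrows, _⟩ := intrinsicInterior_subset hν
  have hz : ∑ j, ν z j = 1 := hrows z Nat.zero_lt_one
  obtain ⟨δ, hδ, hmargin⟩ := exists_hasMargin hν_pos hz.le
    (fun i hi => sum_row_lt_one_of_mem_intrinsicInterior hν rfl hi)
    (sum_col_lt_one_of_mem_intrinsicInterior hn hν)
  have : Nonempty (PMF (SwitchMat n)) := ⟨PMF.pure 0⟩
  choose! π hπ using fun ε hε =>
    (hmw ε hε).exists_queueConvergesTo hε (hA ε hε) hcap hν_pos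
  have hnear : ∀ᶠ ε : ℝ in 𝓝[>] 0, ε ∈ Set.Ioo (0 : ℝ) 1 := Ioo_mem_nhdsGT zero_lt_one
  have hAnear := hnear.mono hA
  have hdrift := eventually_hasPerpDrift hcap hz hδ hmargin
  have hvar : Tendsto (fun ε => ∑ j, arrivalVar (A ε) z j) (𝓝[>] 0) (𝓝 (∑ j, σ z j ^ 2)) :=
    tendsto_finsetSum _ fun j _ => hσ z j
  have hempty : ∀ᶠ ε in 𝓝[>] 0, QueueConvergesTo (A ε) (mw ε) (PMF.pure 0) (π ε) :=
    hnear.mono fun ε hε => hπ ε hε _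
  refine ⟨π, hπ, ?_, fun i hi j => ?_, fun p init π' hπ' => ?_⟩
  · exact tendsto_mul_meanRowQueue hAnear hz hvar hδ hdrift (hnear.mono hmw) hempty
  · exact tendsto_mul_meanQueue_zero hAnear hδ hdrift (hnear.mono hmw) hempty
      (Fin.ne_of_gt hi) j
  · exact ofReal_half_le_liminf_mul_meanRowQueue hAnear hz hvar (hnear.mono hπ')
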